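/- Let $\lambda:\mathbb{Z}_+\to(0,\infty)$ satisfy $0<\inf_x\lambda(x)\le\sup_x\lambda(x)<\infty$, and let $N\ge 1$. Put $\mathbb{W}^n=\{x\in\mathbb{Z}_+^n: x_1<\dots<x_n\}$; write $y\prec x$ for $y\in\mathbb{W}^n$, $x\in\mathbb{W}^{n+1}$ with $x_1\le y_1<x_2\le\dots\le y_n<x_{n+1}$; and let $\mathsf{GT}_N$ be the set of patterns $(x^1,\dots,x^N)$ with $x^k\in\mathbb{W}^k$ and $x^k\prec x^{k+1}$ for $1\le k<N$. *Dynamics.* The push-block dynamics is the continuous-time Markov chain on $\mathsf{GT}_N$ in which each particle $x^n_k$ carries an independent exponential clock of rate $\lambda(x^n_k)$. When it rings, nothing happens if $k<n$ and $x^{n-1}_k=x^n_k$ (blocking); otherwise $x^n_k$ increases by one and, if $x^n_k<x^{n+1}_{k+1}$ no longer holds, $x^{n+1}_{k+1}$ also increases by one, this pushing being propagated to higher levels as long as needed. Thus its transition function is $e^{tG}$, where $Gf(x)=\sum_{p}\lambda(x_p)\,[f(x^{(p)})-f(x)]$, the sum is over all particles $p$, $x_p$ is the position of $p$, and $x^{(p)}$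 is the pattern after the clock of $p$ has rung. *Kernels.* Let $e^{t\mathsf{L}}(x,y)$ be the transition function of the pure-birth chain on $\mathbb{Z}_+$ with generator $\mathsf{L}f(x)=\lambda(x)(f(x+1)-f(x))$. Define $\mathfrak{h}_1\equiv 1$ and, for $n\ge1$, $x\in\mathbb{W}^{n+1}$, $\mathfrak{h}_{n+1}(x)=\sum_{y\prec x}\mathfrak{h}_n(y)\prod_{i=1}^n\lambda(y_i)^{-1}$. Let $$\mathfrak{L}^{n+1}_{n}(x,y)=\frac{\mathfrak{h}_n(y)}{\mathfrak{h}_{n+1}(x)}\prod_{i=1}^n\frac1{\lambda(y_i)}\mathbf{1}(y\prec x),\qquad \mathfrak{P}^n_t(x,y)=\frac{\mathfrak{h}_n(y)}{\mathfrak{h}_n(x)}\det\big(e^{t\mathsf{L}}(x_i,y_j)\big)_{i,j=1}^n .$$ *Statement.* Let $\mathfrak{M}^N$ be a probability measure on $\mathbb{W}^N$ and let $(\mathsf{X}^1(t),\dots,\mathsf{X}^N(t))_{t\ge0}$ be the push-block dynamics started from the Gibbs measure on $\mathsf{GT}_N$ with density $$\mathsf{M}_N(x^1,\dots,x^N)=\mathfrak{M}^N(x^N)\,\mathfrak{L}^N_{N-1}(x^N,x^{N-1})\cdots\mathfrak{L}^2_1(x^2,x^1).$$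 Then: 1. for every $1\le k\le N$, $(\mathfrak{P}^k_t)_{t\ge0}$ is a semigroup of Markov kernels on $\mathbb{W}^k$ and the projection $(\mathsf{X}^k(t))_{t\ge0}$ on the $k$-th level is a Markov process (in its own filtration) with semigroup $(\mathfrak{P}^k_t)_{t\ge0}$; 2. for every fixed $T\ge0$ and $(x^1,\dots,x^N)\in\mathsf{GT}_N$, $$\mathbb{P}\big(\mathsf{X}^1(T)=x^1,\dots,\mathsf{X}^N(T)=x^N\big)=\big[\mathfrak{M}^N\mathfrak{P}^N_T\big](x^N)\,\mathfrak{L}^N_{N-1}(x^N,x^{N-1})\cdots\mathfrak{L}^2_1(x^2,x^1),$$ where $[\mathfrak{M}^N\mathfrak{P}^N_T](z)=\sum_{w\in\mathbb{W}^N}\mathfrak{M}^N(w)\,\mathfrak{P}^N_T(w,z)$. -/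

import Mathlib

open MeasureTheory
open scoped NNReal

noncomputable section

namespace PushBlock

/-! ### Configurations -/

/-- The discrete Weyl chamber: strictly increasing `n`-tuples of non-negative integers. -/
@[ext]
structure Chamber (n : ℕ) where
  pos : Fin n → ℕ
  strictMono : StrictMono pos

/-- Interlacing `y ≺ x`: `x₁ ≤ y₁ < x₂ ≤ y₂ < ⋯ ≤ yₙ < xₙ₊₁`. -/
def Interlaces {n : ℕ} (y : Chamber n) (x : Chamber (n + 1)) : Prop :=
  ∀ i : Fin n, x.pos i.castSucc ≤ y.pos i ∧ y.pos i < x.pos i.succ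

/-- Gelfand-Tsetlin patterns with `N` levels. The level numbered `k : Fin N` here (counted from
`0`) is the `(k+1)`-st level and carries `k + 1` particles. -/
@[ext]
structure GT (N : ℕ) where
  level : (k : Fin N) → Chamber ((k : ℕ) + 1)
  interlaces : ∀ (k : ℕ) (hk : k + 1 < N),
    Interlaces (level ⟨k, Nat.lt_of_succ_lt hk⟩) (level ⟨k + 1, hk⟩)

instance (n : ℕ) : MeasurableSpace (Chamber n) := ⊤

instance (N : ℕ) : MeasurableSpace (GT N) := ⊤

/-- The labels of the particles: a level together with the index of a particle on that level
(both counted from `0`). -/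
abbrev Particle (N : ℕ) : Type := (k : Fin N) × Fin ((k : ℕ) + 1)

/-- The position of a particle in a pattern. -/
def GT.pos {N : ℕ} (x : GT N) (p : Particle N) : ℕ := (x.level p.1).pos p.2

/-- `q` carries the same index as `p`, one level above `p`. -/
def Particle.SameIndexAbove {N : ℕ} (p q : Particle N) : Prop :=
  (q.1 : ℕ) = p.1 + 1 ∧ (q.2 : ℕ) = p.2

/-- `q` carries the next index after that of `p`, one level above `p`. -/
def Particle.NextIndexAbove {N : ℕ} (p q : Particle N) : Prop :=
  (q.1 : ℕ) = p.1 + 1 ∧ (q.2 : ℕ) = p.2 + 1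

/-! ### The push-block mechanism -/

/-- The particle `p` is blocked: the particle with the same index on the level below has the
same position. -/
def Blocked {N : ℕ} (x : GT N) (p : Particle N) : Prop :=
  ∃ q : Particle N, q.SameIndexAbove p ∧ x.pos q = x.pos p

/-- The particles that move to the right by one when `p` jumps: `p` itself and, recursively, every
particle `q'` which is next-index-above a moving particle `q` and whose strict inequality
`pos q < pos q'` would be broken by the move of `q`. -/
inductive Moves {N : ℕ} (x : GT N) (p : Particle N) : Particle N → Prop
  | self : Moves x p p
  | push (q q' : Particle N) : Moves x p q → q.NextIndexAbove q' → ¬ (x.pos q + 1 < x.pos q') →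
      Moves x p q'

theorem GT.pos_le {N : ℕ} (x : GT N) {q p : Particle N} (h : q.SameIndexAbove p) :
    x.pos p ≤ x.pos q := by
  obtain ⟨⟨k, hk⟩, ⟨i, hi⟩⟩ := q
  obtain ⟨⟨k', hk'⟩, ⟨i', hi'⟩⟩ := p
  obtain ⟨h1, h2⟩ := h
  dsimp at h1 h2
  subst h1 h2
  exact (x.interlaces k hk' ⟨i', hi⟩).1

theorem GT.pos_lt {N : ℕ} (x : GT N) {q p : Particle N} (h : q.NextIndexAbove p) :
    x.pos q < x.pos p := by
  obtain ⟨⟨k, hk⟩, ⟨i, hi⟩⟩ := q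
  obtain ⟨⟨k', hk'⟩, ⟨i', hi'⟩⟩ := p
  obtain ⟨h1, h2⟩ := h
  dsimp at h1 h2
  subst h1 h2
  exact (x.interlaces k hk' ⟨i, hi⟩).2

theorem GT.add_one_lt_of_below {N : ℕ} (x : GT N) {k : Fin N} {i j : Fin ((k : ℕ) + 1)}
    (hij : i < j)
    (h : ∀ q0 : Particle N, q0.SameIndexAbove ⟨k, i⟩ → x.pos ⟨k, i⟩ + 1 ≤ x.pos q0) :
    x.pos ⟨k, i⟩ + 1 < x.pos ⟨k, j⟩ := by
  obtain ⟨k, hk⟩ := k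
  obtain ⟨i, hi⟩ := i
  obtain ⟨j, hj⟩ := j
  have hij' : i < j := hij
  dsimp at hi hj
  obtain ⟨m, rfl⟩ : ∃ m, k = m + 1 := ⟨k - 1, by omega⟩
  have h1 := h ⟨⟨m, by omega⟩, ⟨i, by dsimp; omega⟩⟩ ⟨rfl, rfl⟩
  have h2 := x.pos_lt (q := ⟨⟨m, by omega⟩, ⟨i, by dsimp; omega⟩⟩)
    (p := ⟨⟨m + 1, hk⟩, ⟨i + 1, by dsimp; omega⟩⟩) ⟨rfl, rfl⟩
  have h3 : x.pos ⟨⟨m + 1, hk⟩, ⟨i + 1, by dsimp; omega⟩⟩ ≤ x.pos ⟨⟨m + 1, hk⟩, ⟨j, hj⟩⟩ :=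
    (x.level ⟨m + 1, hk⟩).strictMono.monotone (by simp only [Fin.mk_le_mk]; omega)
  omega

theorem Moves.add_one_le {N : ℕ} {x : GT N} {p q : Particle N} (hp : ¬ Blocked x p)
    (h : Moves x p q) :
    ∀ q0 : Particle N, q0.SameIndexAbove q → x.pos q + 1 ≤ x.pos q0 := by
  induction h with
  | self =>
    intro q0 h0
    have h1 := x.pos_le h0
    have h2 : x.pos q0 ≠ x.pos p := fun h => hp ⟨q0, h0, h⟩
    omega
  | push r q _ hrq hb ih =>
    intro q0 h0
    obtain ⟨⟨k, hk⟩, ⟨i, hi⟩⟩ := r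
    obtain ⟨⟨k', hk'⟩, ⟨j, hj⟩⟩ := q0
    have e : k' = k := by
      have := hrq.1
      have := h0.1
      dsimp at *
      omega
    subst e
    have hij : i < j := by
      have := hrq.2
      have := h0.2
      dsimp at *
      omega
    have := x.add_one_lt_of_below (k := ⟨k', hk⟩) (i := ⟨i, hi⟩) (j := ⟨j, hj⟩) hij ih
    omega

open Classical in
/-- The pattern after an unblocked jump of `p`, with all the pushes that it triggers. -/
def jump {N : ℕ} (x : GT N) (p : Particle N) (hp : ¬ Blocked x p) : GT N where
  level k :=
    { pos := fun i => x.pos ⟨k, i⟩ + if Moves x p ⟨k, i⟩ then 1 else 0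
      strictMono := by
        intro i j hij
        have h0 : x.pos ⟨k, i⟩ < x.pos ⟨k, j⟩ := (x.level k).strictMono hij
        dsimp only
        by_cases h : Moves x p ⟨k, i⟩
        · have := x.add_one_lt_of_below hij (h.add_one_le hp)
          rw [if_pos h]
          omega
        · rw [if_neg h]
          omega }
  interlaces := by
    intro k hk i
    dsimp only
    constructor
    · have h0 := x.pos_le (q := ⟨⟨k, Nat.lt_of_succ_lt hk⟩, i⟩)
        (p := ⟨⟨k + 1, hk⟩, i.castSucc⟩) ⟨rfl, rfl⟩
      by_cases h : Moves x p ⟨⟨k + 1, hk⟩, i.castSucc⟩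
      · have := h.add_one_le hp ⟨⟨k, Nat.lt_of_succ_lt hk⟩, i⟩ ⟨rfl, rfl⟩
        rw [if_pos h]
        omega
      · rw [if_neg h]
        omega
    · have hn : Particle.NextIndexAbove (N := N) ⟨⟨k, Nat.lt_of_succ_lt hk⟩, i⟩
        ⟨⟨k + 1, hk⟩, i.succ⟩ := ⟨rfl, rfl⟩
      have h0 := x.pos_lt hn
      by_cases h : Moves x p ⟨⟨k, Nat.lt_of_succ_lt hk⟩, i⟩
      · rw [if_pos h]
        by_cases hb : x.pos ⟨⟨k, Nat.lt_of_succ_lt hk⟩, i⟩ + 1 < x.pos ⟨⟨k + 1, hk⟩, i.succ⟩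
        · omega
        · rw [if_pos (Moves.push _ _ h hn hb)]
          omega
      · rw [if_neg h]
        omega

open Classical in
/-- The pattern after the clock of `p` rings: unchanged if `p` is blocked. -/
def ring {N : ℕ} (x : GT N) (p : Particle N) : GT N :=
  if hp : Blocked x p then x else jump x p hp

/-! ### Generators and the transition functions that they generate -/

/-- The rates are bounded away from `0` and `∞`. -/
def UB (rate : ℕ → ℝ) : Prop :=
  ∃ s M : ℝ, 0 < s ∧ ∀ x, s ≤ rate x ∧ rate x ≤ M

/-- The transition function `e^{tA}(x,y) = ∑ₘ tᵐ/m! (Aᵐ 𝟙_{y})(x)` generated by an operator `A`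
on functions. It is used only for generators with bounded jump rates, which are bounded in the
sup norm, so that the series converges absolutely. -/
def expKernel {S : Type*} (A : (S → ℝ) → (S → ℝ)) (t : ℝ) (x y : S) : ℝ :=
  ∑' m : ℕ, t ^ m / (m.factorial : ℝ) * (A^[m] (Set.indicator {y} 1)) x

/-- The generator of the pure-birth chain: from `x` to `x + 1` at rate `rate x`. -/
def birthGenerator (rate : ℕ → ℝ) (f : ℕ → ℝ) (x : ℕ) : ℝ :=
  rate x * (f (x + 1) - f x)

/-- The generator of the push-block dynamics: the clock of each particle rings independently, at
the rate attached to the current position of the particle. -/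
def pushBlockGenerator {N : ℕ} (rate : ℕ → ℝ) (f : GT N → ℝ) (x : GT N) : ℝ :=
  ∑ p : Particle N, rate (x.pos p) * (f (ring x p) - f x)

/-! ### The single level semigroups and the kernels between levels -/

/-- The Karlin-McGregor kernel `det (e^{tL}(xᵢ, yⱼ))`. -/
def karlinMcGregor (rate : ℕ → ℝ) {n : ℕ} (t : ℝ) (x y : Chamber n) : ℝ :=
  (Matrix.of fun i j : Fin n => expKernel (birthGenerator rate) t (x.pos i) (y.pos j)).det

open Classical in
/-- The kernel `Λ(x,y) = ∏ᵢ 1/λ(yᵢ) 𝟙(y ≺ x)`. -/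
def interlacingKernel (rate : ℕ → ℝ) {n : ℕ} (x : Chamber (n + 1)) (y : Chamber n) : ℝ :=
  if Interlaces y x then ∏ i : Fin n, (rate (y.pos i))⁻¹ else 0

/-- The functions `𝔥ₙ`: `𝔥₁ = 1` and `𝔥ₙ₊₁ = Λ 𝔥ₙ` (a sum with finitely many non-zero terms).
The value for `n = 0` plays no role. -/
def harmonic (rate : ℕ → ℝ) : (n : ℕ) → Chamber n → ℝ
  | 0, _ => 1
  | 1, _ => 1
  | n + 2, x => ∑' y : Chamber (n + 1), interlacingKernel rate x y * harmonic rate (n + 1) y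

/-- The Markov kernel `𝔏` from level `n + 1` to level `n`. -/
def levelKernel (rate : ℕ → ℝ) {n : ℕ} (x : Chamber (n + 1)) (y : Chamber n) : ℝ :=
  harmonic rate n y / harmonic rate (n + 1) x * interlacingKernel rate x y

/-- The transition function `𝔓ₜ` on level `n`. -/
def levelSemigroup (rate : ℕ → ℝ) {n : ℕ} (t : ℝ) (x y : Chamber n) : ℝ :=
  harmonic rate n y / harmonic rate n x * karlinMcGregor rate t x y

/-- The density on patterns with `N + 1` levels obtained from a density `m` on the top level by
applying successively the Markov kernels `𝔏`. -/
def gibbs (rate : ℕ → ℝ) {N : ℕ} (m : Chamber (N + 1) → ℝ) (x : GT (N + 1)) : ℝ :=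
  m (x.level (Fin.last N)) *
    ∏ k : Fin N, levelKernel rate (x.level k.succ) (x.level k.castSucc)

/-! ### Markov processes on countable state spaces -/

/-- `p` is a semigroup of Markov (stochastic) kernels. -/
structure IsMarkovSemigroup {S : Type*} (p : ℝ → S → S → ℝ) : Prop where
  nonneg : ∀ t, 0 ≤ t → ∀ x y, 0 ≤ p t x y
  hasSum_one : ∀ t, 0 ≤ t → ∀ x, HasSum (p t x) 1
  zero_self : ∀ x, p 0 x x = 1
  zero_ne : ∀ x y, x ≠ y → p 0 x y = 0
  chapman_kolmogorov : ∀ s t, 0 ≤ s → 0 ≤ t → ∀ x z,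
    HasSum (fun y => p s x y * p t y z) (p (s + t) x z)

/-- `X` is a Markov process with transition function `p` (on a countable state space `S`): for all
times `t₀ ≤ t₁ ≤ ⋯ ≤ tₙ` and states `x₀, …, xₙ`,
`ℙ(X(t₀) = x₀, …, X(tₙ) = xₙ) = ℙ(X(t₀) = x₀) ∏ᵢ p (tᵢ₊₁ - tᵢ) xᵢ xᵢ₊₁`. -/
structure IsMarkovProcess {Ω S : Type*} [MeasurableSpace Ω] [MeasurableSpace S]
    (μ : Measure Ω) (X : ℝ≥0 → Ω → S) (p : ℝ → S → S → ℝ) : Prop where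
  measurable : ∀ t, Measurable (X t)
  path : ∀ (n : ℕ) (t : Fin (n + 1) → ℝ≥0) (x : Fin (n + 1) → S), Monotone t →
    μ.real {ω | ∀ i, X (t i) ω = x i} =
      μ.real {ω | X (t 0) ω = x 0} *
        ∏ i : Fin n, p ((t i.succ : ℝ) - (t i.castSucc : ℝ)) (x i.castSucc) (x i.succ)

/-- `X` is the push-block process with rate function `rate`, started from the distribution on
patterns with density `m`. -/
structure IsPushBlockProcess {Ω : Type*} [MeasurableSpace Ω] (μ : Measure Ω) (rate : ℕ → ℝ)
    {N : ℕ} (m : GT N → ℝ) (X : ℝ≥0 → Ω → GT N) : Prop where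
  markov : IsMarkovProcess μ X (expKernel (pushBlockGenerator rate))
  initial : ∀ x, μ.real {ω | X 0 ω = x} = m x

end PushBlock

end

noncomputable section

namespace PushBlock

/-! ### Summable functions and operators on them -/

/-! The Gibbs density factors as `m z / h z` at the top configuration `z`, with `h` the function
`harmonic`, times the product of the inverse rates of all lower particles (`gibbs_eq`). The
push-block generator is applied to such a density by running jumps backwards. The predecessors of a
pattern are indexed by its lowerable particles (`pullEquiv`), the rates along a chain of pushes
cancel (`weight_pull`), and the particles below the top that cannot be lowered balance the blocked
ones (`sum_blocked_eq`). What survives acts on the top level alone, as independent birth chains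
killed at collision (`pushBlockDual_apply_of_weight`).

This identity is used twice. Its total mass is zero, which says that `h` is harmonic for the killed
chain (`killedGenerator_harmonic`). It also says that the operator from top densities to Gibbs
densities intertwines the Doob transform of the killed generator with the push-block generator
(`gibbsOp_comp_levelDual`). The Karlin-McGregor determinant is the exponential of the killed
generator (`hasSum_karlinMcGregor`), so the Doob transform generates the level semigroup
(`levelSemigroup_eq_expKernel`).

All generators are bounded on summable functions, so intertwinings of generators pass to the
semigroups (`L1.exp_intertwine`). This gives the law at time `T`, and by the Rogers-Pitman criterion
the Markov property of the top level. The lower levels never feel the top one: by Dynkin's criterion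
the pattern without its top level is again a push-block process (`map_dropTop_comp_pushBlockDual`),
with a Gibbs initial law (`map_dropTop_gibbsOp`), and induction on the number of levels finishes. -/

/-- The Banach space of summable real functions on `S`. -/
abbrev L1 (S : Type*) : Type _ := lp (fun _ : S => ℝ) 1

namespace L1

variable {S S' : Type*}

theorem summable_norm (ν : L1 S) : Summable fun x => ‖ν x‖ := by
  have h := (lp.hasSum_norm (p := 1) (by simp) ν).summable
  simpa using h

theorem summable (ν : L1 S) : Summable fun x => ν x := ν.summable_norm.of_norm

theorem norm_eq (ν : L1 S) : ‖ν‖ = ∑' x, ‖ν x‖ := by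
  have h := lp.norm_eq_tsum_rpow (p := 1) (by simp) ν
  simpa using h

/-- A summable function as an element of `L1`. -/
def ofSummable (f : S → ℝ) (hf : Summable f) : L1 S :=
  ⟨f, memℓp_gen (by simpa using hf.norm)⟩

@[simp]
theorem ofSummable_apply (f : S → ℝ) (hf : Summable f) (x : S) : ofSummable f hf x = f x := rfl

open Classical in
/-- The point mass at `x`. -/
def dirac (x : S) : L1 S := lp.single 1 x 1

open Classical in
theorem dirac_apply (x y : S) : dirac x y = if x = y then 1 else 0 := by
  simp [dirac, lp.single_apply, Pi.single_apply, eq_comm]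

@[simp]
theorem dirac_self (x : S) : dirac x x = 1 := by simp [dirac_apply]

theorem dirac_ne {x y : S} (h : x ≠ y) : dirac x y = 0 := by simp [dirac_apply, h]

theorem norm_dirac (x : S) : ‖dirac x‖ = 1 := by
  classical
  simp [dirac, lp.norm_single]

theorem hasSum_dirac (ν : L1 S) : HasSum (fun x => ν x • dirac x) ν := by
  classical
  have h := lp.hasSum_single (p := 1) (by simp) ν
  convert h using 2 with x
  rw [dirac, ← lp.single_smul]
  simp

variable {E : Type*} [NormedAddCommGroup E] [NormedSpace ℝ E]

theorem hasSum_apply (T : L1 S →L[ℝ] E) (ν : L1 S) :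
    HasSum (fun x => ν x • T (dirac x)) (T ν) := by
  simpa using ν.hasSum_dirac.mapL T

/-- Every summable function is a norm-convergent combination of point masses. All operator
identities below are checked on point masses through this lemma. -/
theorem clm_ext {T T' : L1 S →L[ℝ] E} (h : ∀ x, T (dirac x) = T' (dirac x)) : T = T' := by
  ext1 ν
  refine (hasSum_apply T ν).unique ?_
  simpa only [h] using hasSum_apply T' ν

theorem apply_sum {ι : Type*} (s : Finset ι) (f : ι → L1 S) (x : S) :
    (∑ i ∈ s, f i) x = ∑ i ∈ s, f i x := by
  rw [lp.coeFn_sum, Finset.sum_apply]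

theorem smul_apply (c : ℝ) (ν : L1 S) (x : S) : (c • ν) x = c * ν x := rfl

theorem sub_apply (ν ν' : L1 S) (x : S) : (ν - ν') x = ν x - ν' x := rfl

/-- Evaluation at a point. -/
def eval (y : S) : L1 S →L[ℝ] ℝ := lp.evalCLM ℝ (fun _ : S => ℝ) 1 y

@[simp]
theorem eval_apply (y : S) (ν : L1 S) : eval y ν = ν y := rfl

theorem hasSum_apply_apply (T : L1 S →L[ℝ] L1 S') (ν : L1 S) (y : S') :
    HasSum (fun x => ν x * T (dirac x) y) (T ν y) := by
  simpa using (hasSum_apply ((eval y).comp T) ν)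

/-! ### Operators prescribed on point masses -/

variable [CompleteSpace E]

/-- The operator with prescribed bounded values on point masses. -/
def lift (v : S → E) (C : ℝ) (hv : ∀ x, ‖v x‖ ≤ C) : L1 S →L[ℝ] E :=
  have hs (ν : L1 S) : Summable fun x => ‖ν x • v x‖ :=
    (ν.summable_norm.mul_right C).of_nonneg_of_le (fun _ => norm_nonneg _) fun x => by
      rw [norm_smul]
      exact mul_le_mul_of_nonneg_left (hv x) (norm_nonneg _)
  LinearMap.mkContinuous
    { toFun := fun ν => ∑' x, ν x • v x
      map_add' := fun ν ν' => by
        rw [← (hs ν).of_norm.tsum_add (hs ν').of_norm]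
        simp [add_smul]
      map_smul' := fun c ν => by
        rw [RingHom.id_apply, ← (hs ν).of_norm.tsum_const_smul]
        simp [mul_smul] } C fun ν => by
    rw [norm_eq, mul_comm, ← tsum_mul_right]
    refine (norm_tsum_le_tsum_norm (hs ν)).trans
      ((hs ν).tsum_le_tsum (fun x => ?_) (ν.summable_norm.mul_right C))
    rw [norm_smul]
    exact mul_le_mul_of_nonneg_left (hv x) (norm_nonneg _)

theorem lift_apply (v : S → E) (C : ℝ) (hv : ∀ x, ‖v x‖ ≤ C) (ν : L1 S) :
    lift v C hv ν = ∑' x, ν x • v x := rfl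

@[simp]
theorem lift_dirac (v : S → E) (C : ℝ) (hv : ∀ x, ‖v x‖ ≤ C) (x : S) :
    lift v C hv (dirac x) = v x := by
  rw [lift_apply, tsum_eq_single x]
  · simp
  · intro y hy
    simp [dirac_ne hy.symm]

/-- The total mass. -/
def mass : L1 S →L[ℝ] ℝ := lift (fun _ => 1) 1 (by simp)

theorem mass_apply (ν : L1 S) : mass ν = ∑' x, ν x := by simp [mass, lift_apply]

@[simp]
theorem mass_dirac (x : S) : mass (dirac x) = 1 := by simp [mass]

theorem hasSum_mass (ν : L1 S) : HasSum (fun x => ν x) (mass ν) := by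
  rw [mass_apply]
  exact ν.summable.hasSum

/-- The image of a summable function under a map of the underlying sets. -/
def map (φ : S → S') : L1 S →L[ℝ] L1 S' :=
  lift (fun x => dirac (φ x)) 1 fun _ => (norm_dirac _).le

@[simp]
theorem map_dirac (φ : S → S') (x : S) : map φ (dirac x) = dirac (φ x) := by simp [map]

open Classical in
/-- Restriction to a subset. -/
def restr (B : Set S) : L1 S →L[ℝ] L1 S :=
  lift (fun x => if x ∈ B then dirac x else 0) 1 fun x => by
    split_ifs <;> simp [norm_dirac]

open Classical in
@[simp]
theorem restr_dirac (B : Set S) (x : S) :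
    restr B (dirac x) = if x ∈ B then dirac x else 0 := by simp [restr]

open Classical in
theorem restr_apply (B : Set S) (ν : L1 S) (x : S) :
    restr B ν x = if x ∈ B then ν x else 0 := by
  have h := hasSum_apply_apply (restr B) ν x
  refine h.unique ?_
  have : (if x ∈ B then ν x else 0) = ν x * restr B (dirac x) x := by
    rw [restr_dirac]; split_ifs <;> simp
  rw [this]
  refine hasSum_single x fun y hy => ?_
  rw [restr_dirac]
  split_ifs <;> simp [dirac_ne hy]

theorem map_apply (φ : S → S') (ν : L1 S) (z : S') :
    map φ ν z = mass (restr (φ ⁻¹' {z}) ν) := by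
  have h : (eval z).comp (map φ) = mass.comp (restr (φ ⁻¹' {z})) := by
    refine clm_ext fun x => ?_
    simp only [ContinuousLinearMap.comp_apply, map_dirac, eval_apply, restr_dirac]
    rcases eq_or_ne (φ x) z with h | h
    · rw [if_pos (show x ∈ φ ⁻¹' {z} from h), h, dirac_self, mass_dirac]
    · rw [if_neg (show x ∉ φ ⁻¹' {z} from h), dirac_ne h, map_zero]
  exact congrArg (fun T => T ν) h

/-- Conditioning on one fibre of `φ` leaves no freedom in the image, which is why Dynkin's criterion
yields a product formula. -/
theorem map_restr_preimage (φ : S → S') (ν : L1 S) (z : S') :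
    map φ (restr (φ ⁻¹' {z}) ν) = map φ ν z • dirac z := by
  have h : (map φ).comp (restr (φ ⁻¹' {z})) =
      ((eval z).comp (map φ)).smulRight (dirac z) := by
    refine clm_ext fun x => ?_
    simp only [ContinuousLinearMap.comp_apply, map_dirac, eval_apply, restr_dirac,
      ContinuousLinearMap.smulRight_apply]
    rcases eq_or_ne (φ x) z with h | h
    · rw [if_pos (show x ∈ φ ⁻¹' {z} from h), map_dirac, h, dirac_self, one_smul]
    · rw [if_neg (show x ∉ φ ⁻¹' {z} from h), dirac_ne h, _root_.map_zero, zero_smul]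
  exact congrArg (fun T => T ν) h

/-! ### Exponentials -/

theorem hasSum_exp (A : L1 S →L[ℝ] L1 S) (t : ℝ) (ν : L1 S) :
    HasSum (fun m : ℕ => (t ^ m / (m.factorial : ℝ)) • (A ^ m) ν) (NormedSpace.exp (t • A) ν) := by
  have h := NormedSpace.exp_series_hasSum_exp' (𝕂 := ℝ) (t • A)
  have h2 := (ContinuousLinearMap.apply ℝ (L1 S) ν).hasSum h
  convert h2 using 2 with m
  · simp [smul_pow, smul_smul, div_eq_inv_mul]
  · rfl

/-- The intertwining passes to all powers and then term by term to the exponential series, so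
statements about semigroups reduce to statements about generators. -/
theorem exp_intertwine {A : L1 S →L[ℝ] L1 S} {A' : L1 S' →L[ℝ] L1 S'} {B : L1 S →L[ℝ] L1 S'}
    (h : B.comp A = A'.comp B) (t : ℝ) :
    B.comp (NormedSpace.exp (t • A)) = (NormedSpace.exp (t • A')).comp B := by
  have hpow (m : ℕ) (ν : L1 S) : B ((A ^ m) ν) = (A' ^ m) (B ν) := by
    induction m generalizing ν with
    | zero => simp
    | succ m ih =>
      have h1 := congrArg (fun T => T ν) h
      simp only [ContinuousLinearMap.comp_apply] at h1
      simp only [pow_succ, mul_apply_eq_comp, ih, h1]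
  ext1 ν
  have h1 := B.hasSum (hasSum_exp A t ν)
  refine h1.unique ?_
  simpa only [hpow, map_smul, ContinuousLinearMap.comp_apply] using hasSum_exp A' t (B ν)

theorem exp_add_smul (A : L1 S →L[ℝ] L1 S) (s t : ℝ) :
    NormedSpace.exp ((s + t) • A) = NormedSpace.exp (t • A) * NormedSpace.exp (s • A) := by
  let _ : NormedAlgebra ℚ (L1 S →L[ℝ] L1 S) := NormedAlgebra.restrictScalars ℚ ℝ _
  rw [add_comm, add_smul]
  exact NormedSpace.exp_add_of_commute (((Commute.refl A).smul_left t).smul_right s)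

/-- Each term of the series beyond the zeroth lies in the range of `A` and so has no mass. -/
theorem mass_exp {A : L1 S →L[ℝ] L1 S} (h : ∀ x, mass (A (dirac x)) = 0) (t : ℝ) (ν : L1 S) :
    mass (NormedSpace.exp (t • A) ν) = mass ν := by
  have h0 : mass.comp A = 0 := clm_ext fun x => by simpa using h x
  have hA (ν : L1 S) : mass (A ν) = 0 := congrArg (fun T => T ν) h0
  have h1 := mass.hasSum (hasSum_exp A t ν)
  refine h1.unique ?_
  have := hasSum_single (f := fun m : ℕ => mass ((t ^ m / (m.factorial : ℝ)) • (A ^ m) ν)) 0 ?_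
  · simpa using this
  · intro m hm
    obtain ⟨m, rfl⟩ := Nat.exists_eq_succ_of_ne_zero hm
    simp [pow_succ', hA]

/-- Uniformisation: `A + c` has non-negative entries, hence so do its powers, and the exponential of
`t • A` is that of `t • (A + c)` times the positive scalar `exp (-(t * c))`. -/
theorem exp_nonneg {A : L1 S →L[ℝ] L1 S} {c : ℝ}
    (h : ∀ x y, 0 ≤ A (dirac x) y + c * dirac x y) {t : ℝ} (ht : 0 ≤ t) (x y : S) :
    0 ≤ NormedSpace.exp (t • A) (dirac x) y := by
  let _ : NormedAlgebra ℚ (L1 S →L[ℝ] L1 S) := NormedAlgebra.restrictScalars ℚ ℝ _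
  set B : L1 S →L[ℝ] L1 S := A + c • 1 with hB
  have hBpos (ν : L1 S) (hν : ∀ x, 0 ≤ ν x) (y : S) : 0 ≤ B ν y := by
    refine (hasSum_apply_apply B ν y).nonneg fun x => mul_nonneg (hν x) ?_
    exact h x y
  have hBpow (m : ℕ) (y : S) : 0 ≤ (B ^ m) (dirac x) y := by
    induction m generalizing y with
    | zero =>
      rw [pow_zero, one_apply_eq_self, dirac_apply]
      split_ifs <;> simp
    | succ m ih =>
      rw [pow_succ', mul_apply_eq_comp]
      exact hBpos _ ih y
  have hexp : t • A = t • B + (-(t * c)) • (1 : L1 S →L[ℝ] L1 S) := by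
    rw [hB, smul_add, smul_smul, neg_smul, add_neg_cancel_right]
  have hone : NormedSpace.exp ((-(t * c)) • (1 : L1 S →L[ℝ] L1 S)) (dirac x) =
      Real.exp (-(t * c)) • dirac x := by
    have h1 := hasSum_exp (1 : L1 S →L[ℝ] L1 S) (-(t * c)) (dirac x)
    refine h1.unique ?_
    simp only [one_pow, one_apply_eq_self]
    rw [Real.exp_eq_exp_ℝ]
    exact (NormedSpace.expSeries_div_hasSum_exp (-(t * c))).smul_const _
  rw [hexp, NormedSpace.exp_add_of_commute ((Commute.one_right _).smul_right _),
    mul_apply_eq_comp, hone, map_smul]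
  refine mul_nonneg (Real.exp_pos _).le ?_
  have h2 := (eval y).hasSum (hasSum_exp B t (dirac x))
  refine h2.nonneg fun m => ?_
  simp only [map_smul, eval_apply, smul_eq_mul]
  exact mul_nonneg (by positivity) (hBpow m y)

end L1

/-! ### Jump generators -/

section Jump

variable {S J : Type*} [Fintype J]

/-- The generator of a chain that jumps from `x` to `τ j x` at rate `r j x`. -/
def jumpGenerator (r : J → S → ℝ) (τ : J → S → S) (f : S → ℝ) (x : S) : ℝ :=
  ∑ j, r j x * (f (τ j x) - f x)

/-- The action of a jump generator with bounded rates on summable functions. -/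
def jumpDual (r : J → S → ℝ) (τ : J → S → S) (C : ℝ) (hr : ∀ j x, |r j x| ≤ C) :
    L1 S →L[ℝ] L1 S :=
  L1.lift (fun x => ∑ j, r j x • (L1.dirac (τ j x) - L1.dirac x)) (∑ _j : J, C * 2) fun x => by
    refine norm_sum_le_of_le _ fun j _ => ?_
    rw [norm_smul, Real.norm_eq_abs]
    refine mul_le_mul (hr j x) ?_ (norm_nonneg _) ((abs_nonneg _).trans (hr j x))
    refine (norm_sub_le _ _).trans ?_
    rw [L1.norm_dirac, L1.norm_dirac]
    norm_num

variable {r : J → S → ℝ} {τ : J → S → S} {C : ℝ} (hr : ∀ j x, |r j x| ≤ C)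

@[simp]
theorem jumpDual_dirac (x : S) : jumpDual r τ C hr (L1.dirac x) =
    ∑ j, r j x • (L1.dirac (τ j x) - L1.dirac x) := by
  simp [jumpDual]

/-- Duality of the actions on measures and on functions. The first jump is split off on both sides:
it is the innermost factor for measures and the outermost one for functions. -/
theorem jumpDual_pow_dirac (m : ℕ) (x y : S) :
    (jumpDual r τ C hr ^ m) (L1.dirac x) y =
      ((jumpGenerator r τ)^[m] (Set.indicator {y} 1)) x := by
  induction m generalizing x with
  | zero =>
    classical
    simp [L1.dirac_apply, Pi.single_apply]
  | succ m ih =>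
    rw [pow_succ, mul_apply_eq_comp, jumpDual_dirac, Function.iterate_succ_apply',
      map_sum, L1.apply_sum, jumpGenerator]
    refine Finset.sum_congr rfl fun j _ => ?_
    simp only [map_smul, map_sub, L1.smul_apply, L1.sub_apply, ih]

/-- Identifies the pointwise series with the entries of a norm-convergent operator exponential. -/
theorem expKernel_jumpGenerator (t : ℝ) (x y : S) :
    expKernel (jumpGenerator r τ) t x y =
      NormedSpace.exp (t • jumpDual r τ C hr) (L1.dirac x) y := by
  have h := (L1.eval y).hasSum (L1.hasSum_exp (jumpDual r τ C hr) t (L1.dirac x))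
  rw [← L1.eval_apply, ← h.tsum_eq, expKernel]
  simp only [map_smul, L1.eval_apply, jumpDual_pow_dirac, smul_eq_mul]

theorem isMarkovSemigroup_jumpGenerator (hr0 : ∀ j x, 0 ≤ r j x) (hrC : ∀ j x, r j x ≤ C) :
    IsMarkovSemigroup (expKernel (jumpGenerator r τ)) := by
  have hr (j x) : |r j x| ≤ C := by rw [abs_of_nonneg (hr0 j x)]; exact hrC j x
  have he := expKernel_jumpGenerator (τ := τ) hr
  have h0 (x : S) : NormedSpace.exp ((0 : ℝ) • jumpDual r τ C hr) (L1.dirac x) = L1.dirac x := by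
    rw [zero_smul, NormedSpace.exp_zero]; rfl
  refine ⟨fun t ht x y => ?_, fun t ht x => ?_, fun x => ?_, fun x y hxy => ?_,
    fun s t hs ht x z => ?_⟩
  · rw [he]
    -- The total jump rate out of any state is at most this constant, which therefore compensates
    -- the negative diagonal.
    refine L1.exp_nonneg (c := ∑ _j : J, C) (fun x y => ?_) ht x y
    rw [jumpDual_dirac, L1.apply_sum, Finset.sum_mul, ← Finset.sum_add_distrib]
    refine Finset.sum_nonneg fun j _ => ?_
    have h1 : 0 ≤ L1.dirac x y := by rw [L1.dirac_apply]; split_ifs <;> simp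
    have h2 : 0 ≤ L1.dirac (τ j x) y := by rw [L1.dirac_apply]; split_ifs <;> simp
    simp only [L1.smul_apply, L1.sub_apply]
    have := hrC j x
    nlinarith [hr0 j x, mul_nonneg (hr0 j x) h2, mul_nonneg (sub_nonneg.2 this) h1]
  · have : expKernel (jumpGenerator r τ) t x =
        fun y => NormedSpace.exp (t • jumpDual r τ C hr) (L1.dirac x) y := funext fun y => he t x y
    rw [this]
    have h := L1.hasSum_mass (NormedSpace.exp (t • jumpDual r τ C hr) (L1.dirac x))
    rwa [L1.mass_exp, L1.mass_dirac] at h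
    intro x
    simp
  · rw [he, h0, L1.dirac_self]
  · rw [he, h0, L1.dirac_ne hxy]
  · simp only [he]
    rw [L1.exp_add_smul, mul_apply_eq_comp]
    exact L1.hasSum_apply_apply _ _ _

end Jump

/-! ### Functions of Markov processes -/

section Markov

variable {Ω S S' : Type*} [MeasurableSpace Ω]

/-- Countable additivity over the values of `Y`, used both for the state at one time and for a whole
finite past. -/
theorem hasSum_measureReal_fiber {μ : Measure Ω} [IsFiniteMeasure μ] {T : Type*}
    [Countable T] [MeasurableSpace T] [MeasurableSingletonClass T] {Y : Ω → T}
    (hY : Measurable Y) {E : Set Ω}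
    (hE : MeasurableSet E) :
    HasSum (fun c => μ.real {ω | Y ω = c ∧ ω ∈ E}) (μ.real E) := by
  have hU : E = ⋃ c, {ω | Y ω = c ∧ ω ∈ E} := by ext; simp
  have hd : Pairwise (Function.onFun Disjoint fun c => {ω | Y ω = c ∧ ω ∈ E}) := by
    intro c d hcd
    refine Set.disjoint_left.2 fun ω h1 h2 => hcd (h1.1.symm.trans h2.1)
  have hm (c : T) : MeasurableSet {ω | Y ω = c ∧ ω ∈ E} :=
    (measurableSet_eq_fun hY measurable_const).inter hE
  have h := measure_iUnion (μ := μ) hd hm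
  rw [← hU] at h
  have hs : Summable fun c => (μ {ω | Y ω = c ∧ ω ∈ E}).toReal :=
    ENNReal.summable_toReal (h ▸ measure_ne_top μ E)
  have := hs.hasSum
  rwa [← ENNReal.tsum_toReal_eq fun c => measure_ne_top μ _, ← h] at this

section Path

variable {μ : Measure Ω} [MeasurableSpace S] {X : ℝ≥0 → Ω → S} {p : ℝ → S → S → ℝ}

theorem IsMarkovProcess.path_nat (hX : IsMarkovProcess μ X p) {t : ℕ → ℝ≥0} (ht : Monotone t)
    (x : ℕ → S) (n : ℕ) :
    μ.real {ω | ∀ i ≤ n, X (t i) ω = x i} =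
      μ.real {ω | X (t 0) ω = x 0} *
        ∏ i ∈ Finset.range n, p ((t (i + 1) : ℝ) - (t i : ℝ)) (x i) (x (i + 1)) := by
  have h := hX.path n (fun i => t i) (fun i => x i) fun i j hij => ht hij
  rw [← Fin.prod_univ_eq_prod_range
    (fun i => p ((t (i + 1) : ℝ) - (t i : ℝ)) (x i) (x (i + 1)))]
  have hset : {ω | ∀ i ≤ n, X (t i) ω = x i} = {ω | ∀ i : Fin (n + 1), X (t i) ω = x i} := ?_
  · rw [hset]
    exact h
  ext ω
  exact ⟨fun h i => h i (Nat.lt_succ_iff.1 i.2), fun h i hi => h ⟨i, Nat.lt_succ_iff.2 hi⟩⟩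

theorem IsMarkovProcess.of_path_nat (hm : ∀ t, Measurable (X t))
    (h : ∀ {t : ℕ → ℝ≥0}, Monotone t → ∀ (x : ℕ → S) (n : ℕ),
      μ.real {ω | ∀ i ≤ n, X (t i) ω = x i} =
      μ.real {ω | X (t 0) ω = x 0} *
        ∏ i ∈ Finset.range n, p ((t (i + 1) : ℝ) - (t i : ℝ)) (x i) (x (i + 1))) :
    IsMarkovProcess μ X p := by
  refine ⟨hm, fun n t x ht => ?_⟩
  -- Clamping the index at `n` extends finite sequences to sequences on `ℕ`, constant from `n` on,
  -- so the times stay monotone.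
  let e : ℕ → Fin (n + 1) := fun i => ⟨min i n, by omega⟩
  have he : Monotone e := fun i j hij => Fin.mk_le_mk.2 (min_le_min_right n hij)
  have hei (i : ℕ) (hi : i < n + 1) : e i = ⟨i, hi⟩ := Fin.ext (min_eq_left (by omega))
  have h1 := h (t := t ∘ e) (ht.comp he) (x ∘ e) n
  have hset : {ω | ∀ i ≤ n, X ((t ∘ e) i) ω = (x ∘ e) i} = {ω | ∀ i, X (t i) ω = x i} := by
    ext ω
    constructor
    · intro h i
      have := h i (Nat.lt_succ_iff.1 i.2)
      simpa only [Function.comp_apply, hei i i.2] using this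
    · intro h i _
      exact h (e i)
  rw [hset] at h1
  rw [h1, ← Fin.prod_univ_eq_prod_range (fun i => p (((t ∘ e) (i + 1) : ℝ≥0) - ((t ∘ e) i : ℝ≥0))
    ((x ∘ e) i) ((x ∘ e) (i + 1)))]
  have h0 : e 0 = 0 := hei 0 (by omega)
  simp only [Function.comp_apply, h0]
  congr 1
  refine Finset.prod_congr rfl fun i _ => ?_
  rw [hei i (by omega), hei (i + 1) (by omega)]
  rfl

end Path

variable [Countable S] [MeasurableSpace S] [MeasurableSingletonClass S] {X : ℝ≥0 → Ω → S}

theorem measurableSet_cylinder (hX : ∀ t, Measurable (X t)) (B : ℕ → Set S) (t : ℕ → ℝ≥0)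
    (n : ℕ) : MeasurableSet {ω | ∀ i < n, X (t i) ω ∈ B i} := by
  have : {ω | ∀ i < n, X (t i) ω ∈ B i} = ⋂ i, ⋂ (_ : i < n), X (t i) ⁻¹' B i := by
    ext; simp
  rw [this]
  exact MeasurableSet.iInter fun i => MeasurableSet.iInter fun _ =>
    hX _ (Set.to_countable _).measurableSet

variable {μ : Measure Ω} [IsFiniteMeasure μ] {p : ℝ → S → S → ℝ}

/-- The law of `X (t n)` on the event that `X (t i) ∈ B i` for `i < n`. -/
def restrictedLaw (μ : Measure Ω) [IsFiniteMeasure μ] (hX : ∀ t, Measurable (X t))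
    (B : ℕ → Set S) (t : ℕ → ℝ≥0) (n : ℕ) : L1 S :=
  L1.ofSummable (fun x => μ.real {ω | X (t n) ω = x ∧ ω ∈ {ω | ∀ i < n, X (t i) ω ∈ B i}})
    (hasSum_measureReal_fiber (hX (t n)) (measurableSet_cylinder hX B t n)).summable

theorem restrictedLaw_apply (hX : ∀ t, Measurable (X t)) (B : ℕ → Set S) (t : ℕ → ℝ≥0) (n : ℕ)
    (x : S) : restrictedLaw μ hX B t n x =
      μ.real {ω | X (t n) ω = x ∧ ∀ i < n, X (t i) ω ∈ B i} := rfl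

theorem mass_restr_restrictedLaw (hX : ∀ t, Measurable (X t)) (B : ℕ → Set S) (t : ℕ → ℝ≥0)
    (n : ℕ) : L1.mass (L1.restr (B n) (restrictedLaw μ hX B t n)) =
      μ.real {ω | ∀ i ≤ n, X (t i) ω ∈ B i} := by
  refine (L1.hasSum_mass _).unique ?_
  have h := hasSum_measureReal_fiber (μ := μ) (hX (t n)) (measurableSet_cylinder hX B t (n + 1))
  simp only [Nat.lt_succ_iff] at h
  convert h using 2 with x
  rw [L1.restr_apply]
  split_ifs with hx
  · rw [restrictedLaw_apply]
    congr 1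
    ext ω
    simp only [Set.mem_ofPred_eq]
    refine and_congr_right fun h1 => ⟨fun h i hi => ?_, fun h i hi => h i hi.le⟩
    rcases hi.lt_or_eq with hi | rfl
    · exact h i hi
    · exact h1 ▸ hx
  · symm
    convert measureReal_empty (μ := μ)
    ext ω
    simp only [Set.mem_ofPred_eq, Set.mem_empty_iff_false, iff_false, not_and]
    exact fun h1 h => hx (h1 ▸ h n le_rfl)

/-- The defining product formula fixes the state at every time. Summing it over all pasts compatible
with the sets `B i` gives the Markov property for coarser events. -/
theorem IsMarkovProcess.measureReal_step (hX : IsMarkovProcess μ X p) {t : ℕ → ℝ≥0}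
    (ht : Monotone t) (B : ℕ → Set S) (n : ℕ) (x y : S) :
    μ.real {ω | X (t (n + 1)) ω = y ∧ X (t n) ω = x ∧ ∀ i < n, X (t i) ω ∈ B i} =
      μ.real {ω | X (t n) ω = x ∧ ∀ i < n, X (t i) ω ∈ B i} *
        p ((t (n + 1) : ℝ) - (t n : ℝ)) x y := by
  have hY : Measurable fun ω (i : Fin (n + 1)) => X (t i) ω :=
    measurable_pi_lambda _ fun i => hX.measurable _
  have hE2 : MeasurableSet {ω | X (t n) ω = x ∧ ∀ i < n, X (t i) ω ∈ B i} :=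
    (measurableSet_eq_fun (hX.measurable _) measurable_const).inter
      (measurableSet_cylinder hX.measurable B t n)
  have hE1 : MeasurableSet {ω | X (t (n + 1)) ω = y ∧ X (t n) ω = x ∧ ∀ i < n, X (t i) ω ∈ B i} :=
    (measurableSet_eq_fun (hX.measurable _) measurable_const).inter hE2
  refine (hasSum_measureReal_fiber (μ := μ) hY hE1).unique ?_
  refine ((hasSum_measureReal_fiber (μ := μ) hY hE2).mul_right
    (p ((t (n + 1) : ℝ) - (t n : ℝ)) x y)).congr_fun fun c => ?_
  by_cases hc : c (Fin.last n) = x ∧ ∀ i : Fin (n + 1), (i : ℕ) < n → c i ∈ B i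
  · let c' : ℕ → S := fun i => if h : i < n + 1 then c ⟨i, h⟩ else y
    have hc' (i : ℕ) (h : i < n + 1) : c' i = c ⟨i, h⟩ := dif_pos h
    have hcy : c' (n + 1) = y := dif_neg (lt_irrefl _)
    have hcx : c' n = x := (hc' n (Nat.lt_succ_self n)).trans hc.1
    have e2 : {ω | (fun i : Fin (n + 1) => X (t i) ω) = c ∧
        ω ∈ {ω | X (t n) ω = x ∧ ∀ i < n, X (t i) ω ∈ B i}} =
        {ω | ∀ i ≤ n, X (t i) ω = c' i} := by
      ext ω
      simp only [Set.mem_ofPred_eq, funext_iff]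
      constructor
      · rintro ⟨h, -⟩ i hi
        rw [hc' i (by omega), ← h]
      · intro h
        refine ⟨fun i => ?_, ?_, fun i hi => ?_⟩
        · rw [h i (by omega), hc' i i.2]
        · rw [h n le_rfl, hcx]
        · rw [h i hi.le, hc' i (by omega)]
          exact hc.2 ⟨i, by omega⟩ hi
    have e1 : {ω | (fun i : Fin (n + 1) => X (t i) ω) = c ∧
        ω ∈ {ω | X (t (n + 1)) ω = y ∧ X (t n) ω = x ∧ ∀ i < n, X (t i) ω ∈ B i}} =
        {ω | ∀ i ≤ n + 1, X (t i) ω = c' i} := by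
      ext ω
      have h2 := Set.ext_iff.1 e2 ω
      simp only [Set.mem_ofPred_eq] at h2 ⊢
      rw [and_left_comm, h2]
      constructor
      · rintro ⟨h1, h⟩ i hi
        rcases hi.lt_or_eq with hi | rfl
        · exact h i (by omega)
        · rw [h1, hcy]
      · intro h
        exact ⟨by rw [h (n + 1) le_rfl, hcy], fun i hi => h i (by omega)⟩
    rw [e1, e2, hX.path_nat ht, hX.path_nat ht, Finset.prod_range_succ, hcx, hcy, mul_assoc]
  · have hne (ω : Ω) (h : (fun i : Fin (n + 1) => X (t i) ω) = c)
        (h2 : X (t n) ω = x ∧ ∀ i < n, X (t i) ω ∈ B i) : False := by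
      subst h
      exact hc ⟨h2.1, fun i hi => h2.2 i hi⟩
    have e2 : {ω | (fun i : Fin (n + 1) => X (t i) ω) = c ∧
        ω ∈ {ω | X (t n) ω = x ∧ ∀ i < n, X (t i) ω ∈ B i}} = ∅ :=
      Set.eq_empty_of_forall_notMem fun ω h => hne ω h.1 h.2
    have e1 : {ω | (fun i : Fin (n + 1) => X (t i) ω) = c ∧
        ω ∈ {ω | X (t (n + 1)) ω = y ∧ X (t n) ω = x ∧ ∀ i < n, X (t i) ω ∈ B i}} = ∅ :=
      Set.eq_empty_of_forall_notMem fun ω h => hne ω h.1 h.2.2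
    rw [e1, e2, measureReal_empty, zero_mul]

/-- Summation over the state at time `t n`. Path probabilities become a recursion: restrict to the
prescribed set, then apply the transition operator. -/
theorem IsMarkovProcess.restrictedLaw_succ (hX : IsMarkovProcess μ X p) {t : ℕ → ℝ≥0}
    (ht : Monotone t) (B : ℕ → Set S) (n : ℕ) {T : L1 S →L[ℝ] L1 S}
    (hT : ∀ x y, T (L1.dirac x) y = p ((t (n + 1) : ℝ) - (t n : ℝ)) x y) :
    restrictedLaw μ hX.measurable B t (n + 1) =
      T (L1.restr (B n) (restrictedLaw μ hX.measurable B t n)) := by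
  ext y
  refine HasSum.unique ?_ (L1.hasSum_apply_apply T _ y)
  have hE : MeasurableSet {ω | X (t (n + 1)) ω = y ∧ ∀ i < n + 1, X (t i) ω ∈ B i} :=
    (measurableSet_eq_fun (hX.measurable _) measurable_const).inter
      (measurableSet_cylinder hX.measurable B t (n + 1))
  rw [restrictedLaw_apply]
  convert hasSum_measureReal_fiber (μ := μ) (hX.measurable (t n)) hE using 2 with x
  rw [L1.restr_apply, hT]
  split_ifs with hx
  · rw [restrictedLaw_apply, ← hX.measureReal_step ht]
    congr 1
    ext ω
    simp only [Set.mem_ofPred_eq, Nat.lt_succ_iff]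
    constructor
    · rintro ⟨h1, h2, h3⟩
      refine ⟨h2, h1, fun i hi => ?_⟩
      rcases hi.lt_or_eq with hi | rfl
      · exact h3 i hi
      · exact h2 ▸ hx
    · rintro ⟨h1, h2, h3⟩
      exact ⟨h2, h1, fun i hi => h3 i hi.le⟩
  · rw [zero_mul]
    symm
    convert measureReal_empty (μ := μ)
    ext ω
    simp only [Set.mem_ofPred_eq, Set.mem_empty_iff_false, iff_false, not_and, not_forall]
    exact fun h1 _ => ⟨n, Nat.lt_succ_self n, h1 ▸ hx⟩

theorem measureReal_comp_eq_map_restrictedLaw (hX : ∀ t, Measurable (X t)) (φ : S → S')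
    (z : ℕ → S') (t : ℕ → ℝ≥0) (n : ℕ) :
    μ.real {ω | ∀ i ≤ n, φ (X (t i) ω) = z i} =
      L1.map φ (restrictedLaw μ hX (fun i => φ ⁻¹' {z i}) t n) (z n) := by
  rw [L1.map_apply]
  exact (mass_restr_restrictedLaw hX (fun i => φ ⁻¹' {z i}) t n).symm

/-- A function of a Markov process is a Markov process if it has the Markov property in one
step. -/
theorem IsMarkovProcess.comp_of_step [MeasurableSpace S'] (hX : IsMarkovProcess μ X p)
    {φ : S → S'} (hφ : Measurable φ) {q : ℝ → S' → S' → ℝ}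
    (h : ∀ {t : ℕ → ℝ≥0}, Monotone t → ∀ (z : ℕ → S') (n : ℕ),
      L1.map φ (restrictedLaw μ hX.measurable (fun i => φ ⁻¹' {z i}) t (n + 1)) (z (n + 1)) =
        L1.map φ (restrictedLaw μ hX.measurable (fun i => φ ⁻¹' {z i}) t n) (z n) *
          q ((t (n + 1) : ℝ) - (t n : ℝ)) (z n) (z (n + 1))) :
    IsMarkovProcess μ (fun t ω => φ (X t ω)) q := by
  refine IsMarkovProcess.of_path_nat (fun t => hφ.comp (hX.measurable t)) fun {t} ht z n => ?_
  induction n with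
  | zero => simp
  | succ n ih =>
    rw [Finset.prod_range_succ, ← mul_assoc, ← ih,
      measureReal_comp_eq_map_restrictedLaw hX.measurable,
      measureReal_comp_eq_map_restrictedLaw hX.measurable, h ht]

/-- Dynkin's criterion. -/
theorem IsMarkovProcess.comp_of_lumping [MeasurableSpace S'] (hX : IsMarkovProcess μ X p)
    {φ : S → S'} (hφ : Measurable φ) {q : ℝ → S' → S' → ℝ}
    {T : ℝ → L1 S →L[ℝ] L1 S} (hT : ∀ t x y, T t (L1.dirac x) y = p t x y)
    {Q : ℝ → L1 S' →L[ℝ] L1 S'} (hQ : ∀ t x y, Q t (L1.dirac x) y = q t x y)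
    (hTQ : ∀ t, (L1.map φ).comp (T t) = (Q t).comp (L1.map φ)) :
    IsMarkovProcess μ (fun t ω => φ (X t ω)) q := by
  refine hX.comp_of_step hφ fun {t} ht z n => ?_
  rw [hX.restrictedLaw_succ ht _ n (hT _)]
  have h (ν : L1 S) (s : ℝ) : L1.map φ (T s ν) = Q s (L1.map φ ν) :=
    congrArg (fun A => A ν) (hTQ s)
  rw [h, L1.map_restr_preimage, map_smul, L1.smul_apply, hQ]

/-- The law at time `t` in terms of the law at time `0`. -/
theorem IsMarkovProcess.measureReal_eq (hX : IsMarkovProcess μ X p)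
    {T : ℝ → L1 S →L[ℝ] L1 S} (hT : ∀ t x y, T t (L1.dirac x) y = p t x y)
    {ν : L1 S} (hν : ∀ x, μ.real {ω | X 0 ω = x} = ν x) (t : ℝ≥0) (x : S) :
    μ.real {ω | X t ω = x} = T t ν x := by
  -- Only the two times `0` and `t` matter.
  let s : ℕ → ℝ≥0 := fun n => if n = 0 then 0 else t
  have hs : Monotone s := monotone_nat_of_le_succ fun n => by
    simp only [s]
    split_ifs <;> simp_all
  have h := hX.restrictedLaw_succ hs (fun _ => Set.univ) 0 (hT _)
  have h0 : restrictedLaw μ hX.measurable (fun _ => Set.univ) s 0 = ν := by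
    ext x
    rw [restrictedLaw_apply, ← hν]
    simp [s]
  have h1 : L1.restr Set.univ ν = ν := by
    ext x
    simp [L1.restr_apply]
  rw [h0, h1] at h
  have h2 := congrArg (fun ν : L1 S => ν x) h
  simp only [restrictedLaw_apply] at h2
  simpa [s] using h2

/-- The criterion of Rogers and Pitman. -/
theorem IsMarkovProcess.comp_of_intertwining [MeasurableSpace S'] (hX : IsMarkovProcess μ X p)
    {φ : S → S'} (hφ : Measurable φ) {q : ℝ → S' → S' → ℝ}
    {T : ℝ → L1 S →L[ℝ] L1 S} (hT : ∀ t x y, T t (L1.dirac x) y = p t x y)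
    {Q : ℝ → L1 S' →L[ℝ] L1 S'} (hQ : ∀ t x y, Q t (L1.dirac x) y = q t x y)
    {Λ : L1 S' →L[ℝ] L1 S} (hTQ : ∀ t, Λ.comp (Q t) = (T t).comp Λ)
    (hsupp : ∀ z x, φ x ≠ z → Λ (L1.dirac z) x = 0) (hmass : ∀ z, L1.mass (Λ (L1.dirac z)) = 1)
    {m : L1 S'} (hm : ∀ x, μ.real {ω | X 0 ω = x} = Λ m x) :
    IsMarkovProcess μ (fun t ω => φ (X t ω)) q := by
  have hT' (t : ℝ) (ν : L1 S') : T t (Λ ν) = Λ (Q t ν) :=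
    (congrArg (fun A => A ν) (hTQ t)).symm
  -- Each `Λ (L1.dirac w)` lives on the fibre over `w`, so restriction to the fibre over `z` picks
  -- out the contribution of `z`.
  have hrestr (ν : L1 S') (z : S') : L1.restr (φ ⁻¹' {z}) (Λ ν) = ν z • Λ (L1.dirac z) := by
    have h : (L1.restr (φ ⁻¹' {z})).comp Λ = (L1.eval z).smulRight (Λ (L1.dirac z)) := by
      refine L1.clm_ext fun w => ?_
      ext x
      simp only [ContinuousLinearMap.comp_apply, L1.restr_apply, L1.eval_apply,
        ContinuousLinearMap.smulRight_apply, L1.smul_apply, Set.mem_preimage,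
        Set.mem_singleton_iff]
      rcases eq_or_ne w z with rfl | hwz
      · rw [L1.dirac_self, one_mul]
        split_ifs with h
        · rfl
        · exact (hsupp _ _ h).symm
      · rw [L1.dirac_ne hwz, zero_mul]
        split_ifs with h
        · exact hsupp _ _ fun h' => hwz (h'.symm.trans h)
        · rfl
    exact congrArg (fun A => A ν) h
  have hmap (ν : L1 S') (z : S') : L1.map φ (Λ ν) z = ν z := by
    rw [L1.map_apply, hrestr, map_smul, hmass, smul_eq_mul, mul_one]
  refine hX.comp_of_step hφ fun {t} ht z n => ?_
  -- The range of `Λ` is preserved both by the evolution, through the intertwining, and by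
  -- conditioning on the observed value, through `hrestr`. The first observation time may be
  -- positive, hence the factor `Q (t 0)` in the base case.
  have key (n : ℕ) : ∃ ν, restrictedLaw μ hX.measurable (fun i => φ ⁻¹' {z i}) t n = Λ ν := by
    induction n with
    | zero =>
      refine ⟨Q (t 0) m, ?_⟩
      ext x
      rw [restrictedLaw_apply, ← hT', ← hX.measureReal_eq hT hm]
      simp
    | succ n ih =>
      obtain ⟨ν, hν⟩ := ih
      rw [hX.restrictedLaw_succ ht _ n (hT _), hν, hrestr, map_smul, hT', ← map_smul]
      exact ⟨_, rfl⟩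
  obtain ⟨ν, hν⟩ := key n
  rw [hX.restrictedLaw_succ ht _ n (hT _), hν, hrestr, map_smul, hT', ← map_smul, hmap, hmap,
    L1.smul_apply, hQ]

end Markov

/-! ### The Karlin-McGregor determinant -/

section Determinant

open PowerSeries

theorem derivation_prod {R A ι : Type*} [CommRing R] [CommRing A] [Algebra R A] [DecidableEq ι]
    (D : Derivation R A A) (s : Finset ι) (f : ι → A) :
    D (∏ i ∈ s, f i) = ∑ k ∈ s, ∏ i ∈ s, if i = k then D (f i) else f i := by
  induction s using Finset.induction_on with
  | empty => simp
  | insert a s ha ih =>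
    rw [Finset.prod_insert ha, D.leibniz, ih, Finset.sum_insert ha, Finset.prod_insert ha,
      if_pos rfl, add_comm, smul_eq_mul, smul_eq_mul, Finset.mul_sum, mul_comm]
    congr 1
    · congr 1
      refine Finset.prod_congr rfl fun i hi => ?_
      rw [if_neg (ne_of_mem_of_not_mem hi ha)]
    · refine Finset.sum_congr rfl fun k hk => ?_
      rw [Finset.prod_insert ha, if_neg (ne_of_mem_of_not_mem hk ha).symm]

theorem derivation_det {R A ι : Type*} [CommRing R] [CommRing A] [Algebra R A] [DecidableEq ι]
    [Fintype ι] (D : Derivation R A A) (M : Matrix ι ι A) :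
    D M.det = ∑ k, (M.updateRow k fun j => D (M k j)).det := by
  have h (M : Matrix ι ι A) : M.det = ∑ σ : Equiv.Perm ι, Equiv.Perm.sign σ • ∏ i, M i (σ i) := by
    -- After transposition the product runs over rows, so differentiating one factor replaces one
    -- row.
    rw [← Matrix.det_transpose, Matrix.det_apply]
    rfl
  simp only [h]
  rw [Finset.sum_comm, map_sum]
  refine Finset.sum_congr rfl fun σ _ => ?_
  rw [← Finset.smul_sum, Units.smul_def, Units.smul_def, map_zsmul, derivation_prod]
  congr 1
  refine Finset.sum_congr rfl fun k _ => Finset.prod_congr rfl fun i _ => ?_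
  rw [Matrix.updateRow_apply]
  split_ifs with h
  · rw [h]
  · rfl

/-! ### Evaluation of formal power series -/

/-- The power series `f` converges at `t`, with sum `v`. -/
def Evaluates (t : ℝ) (f : ℝ⟦X⟧) (v : ℝ) : Prop :=
  HasSum (fun m => coeff m f * t ^ m) v

/-- Real summability is absolute, so the Cauchy product applies. The determinant can thus be
differentiated formally, with convergence settled entry by entry. -/
theorem Evaluates.mul {t : ℝ} {f g : ℝ⟦X⟧} {v w : ℝ} (hf : Evaluates t f v)
    (hg : Evaluates t g w) : Evaluates t (f * g) (v * w) := by
  have hf1 := hf.summable.norm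
  have hg1 := hg.summable.norm
  have h1 (m : ℕ) : coeff m (f * g) * t ^ m = ∑ kl ∈ Finset.HasAntidiagonal.antidiagonal m,
      (coeff kl.1 f * t ^ kl.1) * (coeff kl.2 g * t ^ kl.2) := by
    rw [coeff_mul, Finset.sum_mul]
    refine Finset.sum_congr rfl fun kl hkl => ?_
    rw [← Finset.HasAntidiagonal.mem_antidiagonal.1 hkl, pow_add]
    ring
  have hs := (summable_norm_sum_mul_antidiagonal_of_summable_norm hf1 hg1).of_norm.hasSum
  rw [← tsum_mul_tsum_eq_tsum_sum_antidiagonal_of_summable_norm hf1 hg1, hf.tsum_eq,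
    hg.tsum_eq] at hs
  exact hs.congr_fun h1

theorem Evaluates.one (t : ℝ) : Evaluates t 1 1 := by
  have := hasSum_single (f := fun m => coeff m (1 : ℝ⟦X⟧) * t ^ m) 0 fun m hm => by
    simp [coeff_one, hm]
  simpa [Evaluates] using this

theorem Evaluates.zsmul {t : ℝ} {f : ℝ⟦X⟧} {v : ℝ} (c : ℤ) (hf : Evaluates t f v) :
    Evaluates t (c • f) (c • v) := by
  have h := hf.const_smul c
  refine h.congr_fun fun m => ?_
  rw [map_zsmul, smul_mul_assoc]

theorem Evaluates.sum {ι : Type*} {t : ℝ} {s : Finset ι} {f : ι → ℝ⟦X⟧} {v : ι → ℝ}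
    (h : ∀ i ∈ s, Evaluates t (f i) (v i)) : Evaluates t (∑ i ∈ s, f i) (∑ i ∈ s, v i) := by
  refine (hasSum_sum h).congr_fun fun m => ?_
  rw [map_sum, Finset.sum_mul]

theorem Evaluates.prod {ι : Type*} {t : ℝ} {s : Finset ι} {f : ι → ℝ⟦X⟧} {v : ι → ℝ}
    (h : ∀ i ∈ s, Evaluates t (f i) (v i)) : Evaluates t (∏ i ∈ s, f i) (∏ i ∈ s, v i) := by
  classical
  induction s using Finset.induction_on with
  | empty => simpa using Evaluates.one t
  | insert a s ha ih =>
    rw [Finset.prod_insert ha, Finset.prod_insert ha]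
    exact (h a (Finset.mem_insert_self a s)).mul
      (ih fun i hi => h i (Finset.mem_insert_of_mem hi))

theorem Evaluates.det {ι : Type*} [DecidableEq ι] [Fintype ι] {t : ℝ}
    {F : Matrix ι ι ℝ⟦X⟧} {V : Matrix ι ι ℝ} (h : ∀ i j, Evaluates t (F i j) (V i j)) :
    Evaluates t F.det V.det := by
  rw [Matrix.det_apply, Matrix.det_apply]
  exact Evaluates.sum fun σ _ => (Evaluates.prod fun i _ => h _ _).zsmul _

/-! ### Independent birth chains killed at collision -/

/-- The `i`-th particle of `x` can jump without hitting the next one. -/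
def Chamber.CanRaise {n : ℕ} (x : Chamber n) (i : Fin n) : Prop :=
  ∀ j, i < j → x.pos i + 1 < x.pos j

open Classical in
/-- The configuration after a jump of the `i`-th particle; unchanged if the jump is impossible. -/
def Chamber.raise {n : ℕ} (x : Chamber n) (i : Fin n) : Chamber n :=
  if h : x.CanRaise i then
    { pos := Function.update x.pos i (x.pos i + 1)
      strictMono := by
        intro j k hjk
        have h0 := x.strictMono hjk
        simp only [Function.update_apply]
        split_ifs with h1 h2 h2
        · omega
        · subst h1
          exact h k hjk
        · subst h2
          omega
        · exact h0 }
  else x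

theorem Chamber.raise_pos {n : ℕ} {x : Chamber n} {i : Fin n} (h : x.CanRaise i) :
    (x.raise i).pos = Function.update x.pos i (x.pos i + 1) := by
  rw [Chamber.raise, dif_pos h]

open Classical in
/-- The generator of independent pure-birth chains killed at their first collision. -/
def killedGenerator (rate : ℕ → ℝ) {n : ℕ} (f : Chamber n → ℝ) (x : Chamber n) : ℝ :=
  ∑ i, rate (x.pos i) * ((if x.CanRaise i then f (x.raise i) else 0) - f x)

/-- The exponential series of the pure-birth generator. -/
def birthSeries (rate : ℕ → ℝ) (a b : ℕ) : ℝ⟦X⟧ :=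
  PowerSeries.mk fun m =>
    ((birthGenerator rate)^[m] (Set.indicator {b} 1)) a / (m.factorial : ℝ)

/-- Kolmogorov's backward equation, coefficient by coefficient. -/
theorem derivative_birthSeries (rate : ℕ → ℝ) (a b : ℕ) :
    derivative ℝ (birthSeries rate a b) =
      C (rate a) * (birthSeries rate (a + 1) b - birthSeries rate a b) := by
  ext m
  rw [coeff_derivative, coeff_C_mul, map_sub]
  simp only [birthSeries, coeff_mk, Function.iterate_succ_apply', Nat.factorial_succ]
  rw [birthGenerator]
  have : (m.factorial : ℝ) ≠ 0 := by positivity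
  push_cast
  field_simp

theorem birthGenerator_eq (rate : ℕ → ℝ) :
    birthGenerator rate = jumpGenerator (J := Unit) (fun _ => rate) (fun _ x => x + 1) := by
  funext f x
  simp [birthGenerator, jumpGenerator]

theorem evaluates_birthSeries {rate : ℕ → ℝ} (hrate : UB rate) (t : ℝ) (a b : ℕ) :
    Evaluates t (birthSeries rate a b) (expKernel (birthGenerator rate) t a b) := by
  obtain ⟨s, M, hs, hM⟩ := hrate
  have hr (j : Unit) (x : ℕ) : |(fun _ => rate : Unit → ℕ → ℝ) j x| ≤ M := by
    rw [abs_of_nonneg (hs.le.trans (hM x).1)]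
    exact (hM x).2
  rw [birthGenerator_eq, expKernel_jumpGenerator hr]
  refine ((L1.eval b).hasSum (L1.hasSum_exp _ t (L1.dirac a))).congr_fun fun m => ?_
  rw [map_smul, L1.eval_apply, jumpDual_pow_dirac, birthSeries, coeff_mk, birthGenerator_eq,
    smul_eq_mul]
  ring

/-- The determinant of the exponential series of the pure-birth generator. -/
def detSeries (rate : ℕ → ℝ) {n : ℕ} (x y : Fin n → ℕ) : ℝ⟦X⟧ :=
  (Matrix.of fun i j : Fin n => birthSeries rate (x i) (y j)).det

theorem derivative_detSeries (rate : ℕ → ℝ) {n : ℕ} (x y : Fin n → ℕ) :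
    derivative ℝ (detSeries rate x y) = ∑ i, C (rate (x i)) *
      (detSeries rate (Function.update x i (x i + 1)) y - detSeries rate x y) := by
  rw [detSeries, derivation_det]
  refine Finset.sum_congr rfl fun k _ => ?_
  have h1 : (fun j => derivative ℝ ((Matrix.of fun i j : Fin n =>
      birthSeries rate (x i) (y j)) k j)) = C (rate (x k)) •
        ((fun j => birthSeries rate (x k + 1) (y j)) +
          (-1 : ℝ⟦X⟧) • fun j => birthSeries rate (x k) (y j)) := by
    funext j
    simp only [Matrix.of_apply, derivative_birthSeries, Pi.smul_apply, Pi.add_apply, smul_eq_mul]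
    ring
  rw [h1, Matrix.det_updateRow_smul, Matrix.det_updateRow_add, Matrix.det_updateRow_smul]
  have h2 : (Matrix.of fun i j : Fin n => birthSeries rate (x i) (y j)).updateRow k
      (fun j => birthSeries rate (x k) (y j)) =
        Matrix.of fun i j : Fin n => birthSeries rate (x i) (y j) := by
    exact Matrix.updateRow_eq_self _ k
  have h3 : (Matrix.of fun i j : Fin n => birthSeries rate (x i) (y j)).updateRow k
      (fun j => birthSeries rate (x k + 1) (y j)) =
        Matrix.of fun i j : Fin n => birthSeries rate (Function.update x k (x k + 1) i) (y j) := by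
    ext1 i j
    rw [Matrix.updateRow_apply, Matrix.of_apply, Matrix.of_apply, Function.update_apply]
    split_ifs <;> rfl
  rw [h2, h3, detSeries, neg_one_mul, sub_eq_add_neg]

-- The boundary condition behind the Karlin-McGregor formula: a jump onto the next particle makes
-- two rows of the determinant equal. The free generator therefore acts as the killed one on the
-- chamber.
open Classical in
theorem derivative_detSeries_chamber (rate : ℕ → ℝ) {n : ℕ} (x y : Chamber n) :
    derivative ℝ (detSeries rate x.pos y.pos) = ∑ i, C (rate (x.pos i)) *
      ((if x.CanRaise i then detSeries rate (x.raise i).pos y.pos else 0) -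
        detSeries rate x.pos y.pos) := by
  rw [derivative_detSeries]
  refine Finset.sum_congr rfl fun i _ => ?_
  congr 2
  split_ifs with h
  · rw [Chamber.raise_pos h]
  · simp only [Chamber.CanRaise, not_forall] at h
    obtain ⟨j, hij, h⟩ := h
    have hj : x.pos i + 1 = x.pos j := by
      have := x.strictMono hij
      omega
    refine Matrix.det_zero_of_row_eq hij.ne ?_
    funext k
    rw [Matrix.of_apply, Matrix.of_apply, Function.update_self, Function.update_of_ne hij.ne', hj]

-- A permutation with a non-zero term would give `x` and `y` the same range, and a strictly
-- increasing sequence is determined by its range.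
open Classical in
theorem det_indicator {n : ℕ} (x y : Chamber n) :
    (Matrix.of fun i j : Fin n => if x.pos i = y.pos j then (1 : ℝ) else 0).det =
      if x = y then 1 else 0 := by
  split_ifs with h
  · subst h
    convert Matrix.det_one (n := Fin n) (R := ℝ)
    ext i j
    simp [Matrix.one_apply, x.strictMono.injective.eq_iff]
  · rw [Matrix.det_apply]
    refine Finset.sum_eq_zero fun σ _ => ?_
    suffices h : ∃ i, x.pos (σ i) ≠ y.pos i by
      obtain ⟨i, hi⟩ := h
      rw [Finset.prod_eq_zero (Finset.mem_univ i), smul_zero]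
      simp [hi]
    by_contra! hc
    refine h (Chamber.ext ((StrictMono.range_inj x.strictMono y.strictMono).1 ?_))
    have : y.pos = x.pos ∘ σ := funext fun i => (hc i).symm
    rw [this, Set.range_comp, Equiv.range_eq_univ, Set.image_univ]

/-- The differential equation for the determinant is a recursion for its coefficients, and the
iterates of the killed generator obey the same recursion with the same start. -/
theorem coeff_detSeries (rate : ℕ → ℝ) {n : ℕ} (y : Chamber n) (m : ℕ) (x : Chamber n) :
    coeff m (detSeries rate x.pos y.pos) =
      ((killedGenerator rate)^[m] (Set.indicator {y} 1)) x / (m.factorial : ℝ) := by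
  classical
  induction m generalizing x with
  | zero =>
    have h : coeff 0 (detSeries rate x.pos y.pos) =
        (Matrix.of fun i j : Fin n => if x.pos i = y.pos j then (1 : ℝ) else 0).det := by
      rw [coeff_zero_eq_constantCoeff_apply, detSeries, RingHom.map_det]
      congr 1
      ext i j
      simp [birthSeries, ← coeff_zero_eq_constantCoeff_apply, Pi.single_apply]
    rw [h, det_indicator]
    simp [Pi.single_apply]
  | succ m ih =>
    have h := congrArg (coeff m) (derivative_detSeries_chamber rate x y)
    rw [coeff_derivative, map_sum] at h
    have h2 : coeff (m + 1) (detSeries rate x.pos y.pos) * (m + 1) =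
        killedGenerator rate ((killedGenerator rate)^[m] (Set.indicator {y} 1)) x /
          (m.factorial : ℝ) := by
      rw [h, killedGenerator, Finset.sum_div]
      refine Finset.sum_congr rfl fun i _ => ?_
      rw [coeff_C_mul, map_sub, ih]
      split_ifs
      · rw [ih]
        ring
      · rw [map_zero]
        ring
    rw [Function.iterate_succ_apply', Nat.factorial_succ]
    have : (m.factorial : ℝ) ≠ 0 := by positivity
    have : (m + 1 : ℝ) ≠ 0 := by positivity
    push_cast
    rw [mul_comm, ← div_div, ← h2]
    field_simp

theorem hasSum_karlinMcGregor {rate : ℕ → ℝ} (hrate : UB rate) {n : ℕ} (t : ℝ)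
    (x y : Chamber n) :
    HasSum (fun m : ℕ => t ^ m / (m.factorial : ℝ) *
      ((killedGenerator rate)^[m] (Set.indicator {y} 1)) x) (karlinMcGregor rate t x y) := by
  have h : Evaluates t (detSeries rate x.pos y.pos) (karlinMcGregor rate t x y) :=
    Evaluates.det fun i j => evaluates_birthSeries hrate t _ _
  refine h.congr_fun fun m => ?_
  rw [coeff_detSeries]
  ring

end Determinant

/-! ### The generator of a level -/

open Classical in
/-- The jump rates of a level: the rates of the pure-birth chains transformed by `harmonic`. -/
def levelRate (rate : ℕ → ℝ) {n : ℕ} (i : Fin n) (x : Chamber n) : ℝ :=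
  if x.CanRaise i then rate (x.pos i) * (harmonic rate n (x.raise i) / harmonic rate n x) else 0

/-- The generator of a level. -/
def levelGenerator (rate : ℕ → ℝ) {n : ℕ} : (Chamber n → ℝ) → Chamber n → ℝ :=
  jumpGenerator (levelRate rate) fun i x => x.raise i

/-- Doob's transform: `K (h f) - f K h = h L f` holds term by term, and harmonicity removes the term
with `K h`. -/
theorem killedGenerator_mul (rate : ℕ → ℝ) {n : ℕ} (hpos : ∀ x : Chamber n, 0 < harmonic rate n x)
    (hharm : ∀ x : Chamber n, killedGenerator rate (harmonic rate n) x = 0)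
    (f : Chamber n → ℝ) (x : Chamber n) :
    killedGenerator rate (fun x => harmonic rate n x * f x) x =
      harmonic rate n x * levelGenerator rate f x := by
  have h : killedGenerator rate (fun x => harmonic rate n x * f x) x -
      f x * killedGenerator rate (harmonic rate n) x =
        harmonic rate n x * levelGenerator rate f x := by
    rw [levelGenerator, jumpGenerator, killedGenerator, killedGenerator, Finset.mul_sum,
      Finset.mul_sum, ← Finset.sum_sub_distrib]
    refine Finset.sum_congr rfl fun i _ => ?_
    have := (hpos x).ne'
    rw [levelRate]
    split_ifs
    · field_simp
      ring
    · ring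
  rw [← h, hharm, mul_zero, sub_zero]

theorem iterate_killedGenerator (rate : ℕ → ℝ) {n : ℕ}
    (hpos : ∀ x : Chamber n, 0 < harmonic rate n x)
    (hharm : ∀ x : Chamber n, killedGenerator rate (harmonic rate n) x = 0) (m : ℕ)
    (f : Chamber n → ℝ) :
    (killedGenerator rate)^[m] (fun x => harmonic rate n x * f x) =
      fun x => harmonic rate n x * (levelGenerator rate)^[m] f x := by
  induction m with
  | zero => rfl
  | succ m ih =>
    rw [Function.iterate_succ_apply', ih]
    funext x
    rw [killedGenerator_mul rate hpos hharm, Function.iterate_succ_apply']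

theorem killedGenerator_const_mul (rate : ℕ → ℝ) {n : ℕ} (c : ℝ) (m : ℕ) (f : Chamber n → ℝ) :
    (killedGenerator rate)^[m] (fun x => c * f x) =
      fun x => c * (killedGenerator rate)^[m] f x := by
  induction m with
  | zero => rfl
  | succ m ih =>
    rw [Function.iterate_succ_apply', ih]
    funext x
    rw [Function.iterate_succ_apply', killedGenerator, killedGenerator, Finset.mul_sum]
    refine Finset.sum_congr rfl fun i _ => ?_
    split_ifs <;> ring

/-- Conjugation by `harmonic` passes through every power of the killed generator and hence through
its exponential, which is the Karlin-McGregor kernel. -/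
theorem levelSemigroup_eq_expKernel {rate : ℕ → ℝ} (hrate : UB rate) {n : ℕ}
    (hpos : ∀ x : Chamber n, 0 < harmonic rate n x)
    (hharm : ∀ x : Chamber n, killedGenerator rate (harmonic rate n) x = 0)
    (t : ℝ) (x y : Chamber n) :
    levelSemigroup rate t x y = expKernel (levelGenerator rate) t x y := by
  have h (m : ℕ) : harmonic rate n x * (levelGenerator rate)^[m] (Set.indicator {y} 1) x =
      harmonic rate n y * (killedGenerator rate)^[m] (Set.indicator {y} 1) x := by
    have h1 := congrFun (iterate_killedGenerator rate hpos hharm m (Set.indicator {y} 1)) x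
    have h2 := congrFun (killedGenerator_const_mul rate (harmonic rate n y) m
      (Set.indicator {y} 1)) x
    -- On the indicator of `y`, multiplication by `harmonic` is multiplication by its value at `y`.
    have h3 : (fun x => harmonic rate n x * Set.indicator {y} (1 : Chamber n → ℝ) x) =
        fun x => harmonic rate n y * Set.indicator {y} (1 : Chamber n → ℝ) x := by
      funext x
      by_cases hx : x = y
      · rw [hx]
      · rw [Set.indicator_of_notMem (by simpa using hx), mul_zero, mul_zero]
    rw [← h1, ← h2, h3]
  rw [levelSemigroup, ← (hasSum_karlinMcGregor hrate t x y).tsum_eq, expKernel, ← tsum_mul_left]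
  refine tsum_congr fun m => ?_
  have := (hpos x).ne'
  rw [mul_left_comm]
  congr 1
  rw [div_mul_eq_mul_div, ← h, mul_div_cancel_left₀ _ this]

/-! ### Reversing the push-block mechanism -/

section Reverse

variable {N : ℕ}

theorem Particle.ext_val {p q : Particle N} (h1 : (p.1 : ℕ) = q.1) (h2 : (p.2 : ℕ) = q.2) :
    p = q := by
  obtain ⟨⟨k, hk⟩, ⟨i, hi⟩⟩ := p
  obtain ⟨⟨l, hl⟩, ⟨j, hj⟩⟩ := q
  dsimp at h1 h2
  subst h1 h2
  rfl

theorem GT.ext_pos {x y : GT N} (h : ∀ p, x.pos p = y.pos p) : x = y :=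
  GT.ext (funext fun k => Chamber.ext (funext fun i => h ⟨k, i⟩))

theorem Particle.NextIndexAbove.left_unique {p p' q : Particle N} (h : p.NextIndexAbove q)
    (h' : p'.NextIndexAbove q) : p = p' :=
  Particle.ext_val (by have := h.1; have := h'.1; omega) (by have := h.2; have := h'.2; omega)

theorem Particle.NextIndexAbove.right_unique {p q q' : Particle N} (h : p.NextIndexAbove q)
    (h' : p.NextIndexAbove q') : q = q' :=
  Particle.ext_val (by have := h.1; have := h'.1; omega) (by have := h.2; have := h'.2; omega)

theorem Particle.SameIndexAbove.left_unique {p p' q : Particle N} (h : p.SameIndexAbove q)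
    (h' : p'.SameIndexAbove q) : p = p' :=
  Particle.ext_val (by have := h.1; have := h'.1; omega) (by have := h.2; have := h'.2; omega)

theorem Particle.SameIndexAbove.right_unique {p q q' : Particle N} (h : p.SameIndexAbove q)
    (h' : p.SameIndexAbove q') : q = q' :=
  Particle.ext_val (by have := h.1; have := h'.1; omega) (by have := h.2; have := h'.2; omega)

theorem Particle.exists_sameIndexAbove {p : Particle N} (h : (p.1 : ℕ) + 1 < N) :
    ∃ q : Particle N, p.SameIndexAbove q :=
  ⟨⟨⟨p.1 + 1, h⟩, ⟨p.2, by have := p.2.2; dsimp; omega⟩⟩, rfl, rfl⟩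

theorem GT.pos_jump {x : GT N} {p : Particle N} (hp : ¬ Blocked x p) [DecidablePred (Moves x p)]
    (q : Particle N) : (jump x p hp).pos q = x.pos q + if Moves x p q then 1 else 0 := by
  simp only [GT.pos, jump]
  congr

/-! ### Chains of moves read backwards -/

/-- The particle `q` can be moved to the left by one, if those it would otherwise hit on the levels
below are moved along. -/
structure Lowerable (x : GT N) (q : Particle N) : Prop where
  one_le : 1 ≤ x.pos q
  add_one_lt : ∀ j, j < q.2 → x.pos ⟨q.1, j⟩ + 1 < x.pos q
  above : ∀ r, q.SameIndexAbove r → x.pos r < x.pos q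

/-- Any particle to the left of `q` on its level lies strictly left of the next-index particle above
it, hence of `r`, which lies strictly left of `q`. So the gap to `q` is at least two. -/
theorem Lowerable.of_above {x : GT N} {q r : Particle N} (hr : q.SameIndexAbove r)
    (h : x.pos r < x.pos q) : Lowerable x q := by
  refine ⟨by omega, fun j hj => ?_, fun s hs => hr.right_unique hs ▸ h⟩
  obtain ⟨⟨k, hk⟩, ⟨i, hi⟩⟩ := q
  obtain ⟨⟨l, hl⟩, ⟨i', hi'⟩⟩ := r
  obtain ⟨j, hj'⟩ := j
  obtain ⟨h1, h2⟩ := hr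
  dsimp at h1 h2 hj'
  subst h1 h2
  have hj : j < i' := hj
  have h3 := x.pos_lt (q := ⟨⟨k, hk⟩, ⟨j, hj'⟩⟩)
    (p := ⟨⟨k + 1, hl⟩, ⟨j + 1, by dsimp; omega⟩⟩) ⟨rfl, rfl⟩
  have h4 : x.pos ⟨⟨k + 1, hl⟩, ⟨j + 1, by dsimp; omega⟩⟩ ≤ x.pos ⟨⟨k + 1, hl⟩, ⟨i', hi'⟩⟩ :=
    (x.level ⟨k + 1, hl⟩).strictMono.monotone (by simp only [Fin.mk_le_mk]; omega)
  dsimp only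
  omega

/-- `q` lies one step down from `q'` in a chain of particles that are moved together. -/
def DownStep (x : GT N) (q' q : Particle N) : Prop :=
  q.NextIndexAbove q' ∧ x.pos q + 1 = x.pos q'

/-- The particles that must have moved if `q` was the last one to be pushed. -/
def Back (x : GT N) : Particle N → Particle N → Prop := Relation.ReflTransGen (DownStep x)

/-- The particle `s` just above `r` is a left neighbour of `q`, so `x.pos s + 1 < x.pos q = x.pos r
+ 1`; this is the strict inequality that `r` needs. -/
theorem Lowerable.downStep {x : GT N} {q r : Particle N} (hq : Lowerable x q)
    (h : DownStep x q r) : Lowerable x r := by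
  obtain ⟨⟨h1, h2⟩, h3⟩ := h
  have hq2 := q.2.2
  obtain ⟨s, hs⟩ := Particle.exists_sameIndexAbove (p := r) (by have := q.1.2; omega)
  refine Lowerable.of_above hs ?_
  have hsq : s = ⟨q.1, ⟨r.2, by omega⟩⟩ := Particle.ext_val (by rw [hs.1, h1]) hs.2
  have := hq.add_one_lt ⟨r.2, by omega⟩ (by rw [Fin.lt_def]; dsimp; omega)
  rw [hsq]
  omega

theorem Lowerable.back {x : GT N} {q r : Particle N} (hq : Lowerable x q) (h : Back x q r) :
    Lowerable x r := by
  induction h with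
  | refl => exact hq
  | tail _ h ih => exact ih.downStep h

open Classical in
/-- The pattern before the move of `q` and of the particles moved together with it. -/
def pull (x : GT N) (q : Particle N) (hq : Lowerable x q) : GT N where
  level k :=
    { pos := fun i => x.pos ⟨k, i⟩ - if Back x q ⟨k, i⟩ then 1 else 0
      strictMono := by
        intro i j hij
        have h0 : x.pos ⟨k, i⟩ < x.pos ⟨k, j⟩ := (x.level k).strictMono hij
        dsimp only
        by_cases h : Back x q ⟨k, j⟩
        · have : x.pos ⟨k, i⟩ + 1 < x.pos ⟨k, j⟩ := (hq.back h).add_one_lt i hij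
          rw [if_pos h]
          omega
        · rw [if_neg h]
          omega }
  interlaces := by
    intro k hk i
    dsimp only
    constructor
    · have hs : Particle.SameIndexAbove (N := N) ⟨⟨k, Nat.lt_of_succ_lt hk⟩, i⟩
        ⟨⟨k + 1, hk⟩, i.castSucc⟩ := ⟨rfl, rfl⟩
      have h0 := x.pos_le hs
      by_cases h : Back x q ⟨⟨k, Nat.lt_of_succ_lt hk⟩, i⟩
      · have := (hq.back h).above _ hs
        rw [if_pos h]
        omega
      · rw [if_neg h]
        omega
    · have hn : Particle.NextIndexAbove (N := N) ⟨⟨k, Nat.lt_of_succ_lt hk⟩, i⟩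
        ⟨⟨k + 1, hk⟩, i.succ⟩ := ⟨rfl, rfl⟩
      have h0 := x.pos_lt hn
      by_cases h : Back x q ⟨⟨k + 1, hk⟩, i.succ⟩
      · have h1 := (hq.back h).one_le
        rw [if_pos h]
        by_cases hb : x.pos ⟨⟨k, Nat.lt_of_succ_lt hk⟩, i⟩ + 1 = x.pos ⟨⟨k + 1, hk⟩, i.succ⟩
        · have h2 : Back x q ⟨⟨k, Nat.lt_of_succ_lt hk⟩, i⟩ := Relation.ReflTransGen.tail h ⟨hn, hb⟩
          have h3 := (hq.back h2).one_le
          rw [if_pos h2]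
          omega
        · omega
      · rw [if_neg h]
        omega

theorem GT.pos_pull {x : GT N} {q : Particle N} (hq : Lowerable x q) [DecidablePred (Back x q)]
    (r : Particle N) : (pull x q hq).pos r = x.pos r - if Back x q r then 1 else 0 := by
  simp only [GT.pos, pull]
  congr

theorem pos_pull_add_one {x : GT N} {q r : Particle N} (hq : Lowerable x q) (h : Back x q r) :
    (pull x q hq).pos r + 1 = x.pos r := by
  classical
  have := (hq.back h).one_le
  rw [GT.pos_pull, if_pos h]
  omega

theorem pos_pull_of_not {x : GT N} {q r : Particle N} (hq : Lowerable x q) (h : ¬ Back x q r) :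
    (pull x q hq).pos r = x.pos r := by
  classical
  rw [GT.pos_pull, if_neg h, Nat.sub_zero]

theorem downStep_rightUnique (x : GT N) : Relator.RightUnique (DownStep x) :=
  fun _ _ _ h h' => h.1.left_unique h'.1

theorem Back.level_le {x : GT N} {q r : Particle N} (h : Back x q r) : (r.1 : ℕ) ≤ q.1 := by
  induction h with
  | refl => exact le_rfl
  | tail _ h ih =>
    have := h.1.1
    omega

/-- The first particle to move in the chain that ends in `q`. -/
theorem exists_start (x : GT N) (q : Particle N) :
    ∃ p, Back x q p ∧ ∀ r, ¬ DownStep x p r := by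
  have : Nonempty {r // Back x q r} := ⟨⟨q, Relation.ReflTransGen.refl⟩⟩
  obtain ⟨⟨p, hp⟩, hmin⟩ := Finite.exists_min fun r : {r // Back x q r} => (r.1.1 : ℕ)
  refine ⟨p, hp, fun r hr => ?_⟩
  have := hmin ⟨r, hp.tail hr⟩
  have := hr.1.1
  dsimp at *
  omega

/-- The particle whose clock rang when the chain that ends in `q` moved. -/
def start (x : GT N) (q : Particle N) : Particle N := (exists_start x q).choose

theorem back_start (x : GT N) (q : Particle N) : Back x q (start x q) :=
  (exists_start x q).choose_spec.1

theorem not_downStep_start (x : GT N) (q r : Particle N) : ¬ DownStep x (start x q) r :=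
  (exists_start x q).choose_spec.2 r

/-- Steps down a chain are deterministic, so any two of its members are comparable, and nothing lies
beyond `start`. -/
theorem Back.start_back {x : GT N} {q r : Particle N} (h : Back x q r) : Back x r (start x q) := by
  rcases Relation.ReflTransGen.total_of_right_unique (downStep_rightUnique x) h (back_start x q)
    with h' | h'
  · exact h'
  · rcases Relation.ReflTransGen.cases_head h' with h' | ⟨s, hs, -⟩
    · rw [h']
      exact Relation.ReflTransGen.refl
    · exact absurd hs (not_downStep_start x q s)

/-- A blocker lowered along with the start was strictly to its right before, and stays so; one that
is not lowered is left behind strictly to the right. -/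
theorem not_blocked_pull {x : GT N} {q : Particle N} (hq : Lowerable x q) :
    ¬ Blocked (pull x q hq) (start x q) := by
  rintro ⟨r, hr, he⟩
  have h1 := pos_pull_add_one hq (back_start x q)
  have h2 := x.pos_le hr
  by_cases h : Back x q r
  · have h3 := pos_pull_add_one hq h
    have := (hq.back h).above _ hr
    omega
  · have h3 := pos_pull_of_not hq h
    omega

/-- A lowered particle next to an unlowered one leaves enough room to move back without a push,
whereas two adjacent lowered ones are still adjacent and push. -/
theorem moves_pull_iff {x : GT N} {q : Particle N} (hq : Lowerable x q) (r : Particle N) :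
    Moves (pull x q hq) (start x q) r ↔ Back x q r := by
  constructor
  · intro h
    induction h with
    | self => exact back_start x q
    | push r r' _ hn hb ih =>
      by_contra h
      have h1 := pos_pull_of_not hq h
      have h2 := pos_pull_add_one hq ih
      have h3 := x.pos_lt hn
      omega
  · intro h
    have h1 := h.start_back
    induction h1 using Relation.ReflTransGen.head_induction_on with
    | refl => exact Moves.self
    | head h2 _ ih =>
      have h3 := h.tail h2
      refine Moves.push _ _ (ih h3) h2.1 ?_
      have h4 := pos_pull_add_one hq h
      have h5 := pos_pull_add_one hq h3
      have := h2.2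
      omega

theorem jump_pull {x : GT N} {q : Particle N} (hq : Lowerable x q) :
    jump (pull x q hq) (start x q) (not_blocked_pull hq) = x := by
  classical
  refine GT.ext_pos fun r => ?_
  rw [GT.pos_jump]
  by_cases h : Back x q r
  · rw [if_pos ((moves_pull_iff hq r).2 h), pos_pull_add_one hq h]
  · rw [if_neg (mt (moves_pull_iff hq r).1 h), pos_pull_of_not hq h, Nat.add_zero]

theorem moves_iff_reflTransGen {x : GT N} {p q : Particle N} : Moves x p q ↔
    Relation.ReflTransGen (fun q q' => q.NextIndexAbove q' ∧ ¬ (x.pos q + 1 < x.pos q')) p q := by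
  constructor
  · intro h
    induction h with
    | self => exact Relation.ReflTransGen.refl
    | push r r' _ hn hb ih => exact ih.tail ⟨hn, hb⟩
  · intro h
    induction h with
    | refl => exact Moves.self
    | tail _ h ih => exact Moves.push _ _ ih h.1 h.2

/-- Every unblocked jump arises by reversal. -/
theorem exists_pull_eq {w : GT N} {p : Particle N} (hp : ¬ Blocked w p) :
    ∃ (q : Particle N) (hq : Lowerable (jump w p hp) q),
      pull (jump w p hp) q hq = w ∧ start (jump w p hp) q = p := by
  classical
  set x := jump w p hp with hx
  have hpos : ∀ r, x.pos r = w.pos r + if Moves w p r then 1 else 0 := GT.pos_jump hp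
  have : Nonempty {r // Moves w p r} := ⟨⟨p, Moves.self⟩⟩
  -- The last particle pushed is the one on the highest level.
  obtain ⟨⟨q, hq⟩, hmax⟩ := Finite.exists_max fun r : {r // Moves w p r} => (r.1.1 : ℕ)
  have hend (r : Particle N) (hr : Moves w p r) : ¬ q.NextIndexAbove r := fun h => by
    have := hmax ⟨r, hr⟩
    have := h.1
    dsimp at *
    omega
  have hback (r : Particle N) : Back x q r ↔ Moves w p r := by
    constructor
    · intro h
      induction h with
      | refl => exact hq
      | tail _ h ih =>
        by_contra hn
        have h1 := h.2
        rw [hpos, hpos, if_pos ih, if_neg hn] at h1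
        have := w.pos_lt h.1
        omega
    · intro h
      have hrq := by
        refine Relation.ReflTransGen.total_of_right_unique ?_ (moves_iff_reflTransGen.1 h)
          (moves_iff_reflTransGen.1 hq)
        exact fun _ _ _ h h' => h.1.right_unique h'.1
      rcases hrq with h' | h'
      · clear hend hmax
        induction h' using Relation.ReflTransGen.head_induction_on with
        | refl => exact Relation.ReflTransGen.refl
        | head h2 _ ih =>
          have h3 := Moves.push _ _ h h2.1 h2.2
          refine (ih h3).tail ⟨h2.1, ?_⟩
          rw [hpos, hpos, if_pos h, if_pos h3]
          have := w.pos_lt h2.1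
          have := h2.2
          omega
      · rcases Relation.ReflTransGen.cases_head h' with h' | ⟨s, hs, -⟩
        · rw [h']
          exact Relation.ReflTransGen.refl
        · exact absurd hs.1 (hend s (Moves.push _ _ hq hs.1 hs.2))
  have hxq : x.pos q = w.pos q + 1 := by rw [hpos, if_pos hq]
  have hlow : Lowerable x q := by
    refine ⟨by omega, fun j hj => ?_, fun r hr => ?_⟩
    · rw [hxq, hpos]
      have h0 : w.pos ⟨q.1, j⟩ < w.pos q := (w.level q.1).strictMono hj
      split_ifs with h
      · have := w.add_one_lt_of_below (j := q.2) hj (h.add_one_le hp)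
        have h1 : w.pos ⟨q.1, j⟩ + 1 < w.pos q := this
        omega
      · omega
    · rw [hxq, hpos]
      have := w.pos_le hr
      split_ifs with h
      · have := h.add_one_le hp q hr
        omega
      · omega
  refine ⟨q, hlow, GT.ext_pos fun r => ?_, ?_⟩
  · by_cases h : Moves w p r
    · have := pos_pull_add_one hlow ((hback r).2 h)
      rw [hpos, if_pos h] at this
      omega
    · rw [pos_pull_of_not hlow (mt (hback r).1 h), hpos, if_neg h, Nat.add_zero]
  -- A further step down from `p` would be a moved particle below the level of `p`, but pushes only
  -- go up.
  · have h1 := ((hback p).2 Moves.self).start_back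
    rcases Relation.ReflTransGen.cases_head h1 with h' | ⟨s, hs, h2⟩
    · exact h'.symm
    · have hs' : Moves w p s := (hback s).1 (((hback p).2 Moves.self).tail hs)
      have hle : (p.1 : ℕ) ≤ s.1 := by
        clear h2 hs
        induction hs' with
        | self => exact le_rfl
        | push r r' _ hn _ ih =>
          have := hn.1
          omega
      have := hs.1.1
      omega

/-- The pulled pattern reveals which particles were lowered, and `q` is the highest of them. -/
theorem pull_injective {x : GT N} {q q' : Particle N} (hq : Lowerable x q) (hq' : Lowerable x q')
    (h1 : pull x q hq = pull x q' hq') : q = q' := by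
  have hback (r : Particle N) : Back x q r ↔ Back x q' r := by
    have h2 : (pull x q hq).pos r = (pull x q' hq').pos r := by rw [h1]
    constructor <;> intro h <;> by_contra h'
    · have := pos_pull_add_one hq h
      have := pos_pull_of_not hq' h'
      omega
    · have := pos_pull_add_one hq' h
      have := pos_pull_of_not hq h'
      omega
  have ha := (hback q).1 Relation.ReflTransGen.refl
  have hb := (hback q').2 Relation.ReflTransGen.refl
  rcases Relation.ReflTransGen.cases_head ha with h | ⟨s, hs, h⟩
  · exact h.symm
  · have h3 := Back.level_le h
    have h4 := Back.level_le hb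
    have := hs.1.1
    omega

/-- Unblocked jumps that lead to `x` correspond to particles of `x` that can be lowered. -/
def pullEquiv (x : GT N) : {q // Lowerable x q} ≃
    {wp : GT N × Particle N // ∃ hp : ¬ Blocked wp.1 wp.2, jump wp.1 wp.2 hp = x} :=
  Equiv.ofBijective
    (fun q => ⟨(pull x q.1 q.2, start x q.1), not_blocked_pull q.2, jump_pull q.2⟩) <| by
    constructor
    · rintro ⟨q, hq⟩ ⟨q', hq'⟩ h
      simp only [Subtype.mk.injEq, Prod.mk.injEq] at h
      exact Subtype.ext (pull_injective hq hq' h.1)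
    · rintro ⟨⟨w, p⟩, hp, rfl⟩
      obtain ⟨q, hq, h1, h2⟩ := exists_pull_eq hp
      exact ⟨⟨q, hq⟩, Subtype.ext (Prod.ext h1 h2)⟩

end Reverse

/-! ### Gibbs measures and the push-block generator -/

section Weight

variable {N : ℕ}

/-- The product of the inverse rates of the particles below the top level. -/
def weight (rate : ℕ → ℝ) (x : GT (N + 1)) : ℝ :=
  ∏ r : Particle (N + 1), if (r.1 : ℕ) < N then (rate (x.pos r))⁻¹ else 1

theorem weight_pos {rate : ℕ → ℝ} (hrate : ∀ a, 0 < rate a) (x : GT (N + 1)) :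
    0 < weight rate x := by
  refine Finset.prod_pos fun r _ => ?_
  split_ifs
  · exact inv_pos.2 (hrate _)
  · exact one_pos

theorem weight_eq (rate : ℕ → ℝ) (x : GT (N + 1)) :
    weight rate x = ∏ k : Fin N, ∏ i, (rate ((x.level k.castSucc).pos i))⁻¹ := by
  rw [weight, Fintype.prod_sigma, Fin.prod_univ_castSucc]
  simp only [Fin.val_castSucc, Fin.is_lt, if_true, Fin.val_last, lt_irrefl, if_false,
    Finset.prod_const_one, mul_one]
  rfl

theorem prod_div_telescope {n : ℕ} (a : Fin (n + 1) → ℝ) (ha : ∀ k, a k ≠ 0) :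
    ∏ k : Fin n, a k.castSucc / a k.succ = a 0 / a (Fin.last n) := by
  induction n with
  | zero => simp [ha]
  | succ n ih =>
    rw [Fin.prod_univ_castSucc]
    have h := ih (fun k => a k.castSucc) fun k => ha _
    simp only [Fin.succ_castSucc]
    rw [h, Fin.succ_last, Fin.castSucc_zero]
    have := ha (Fin.last n).castSucc
    have := ha (Fin.last (n + 1))
    field_simp

theorem interlacingKernel_of_interlaces (rate : ℕ → ℝ) {n : ℕ} {x : Chamber (n + 1)}
    {y : Chamber n} (h : Interlaces y x) :
    interlacingKernel rate x y = ∏ i, (rate (y.pos i))⁻¹ := if_pos h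

/-- The ratios of `harmonic` telescope down to the first level, where it equals one. -/
theorem gibbs_eq {rate : ℕ → ℝ} (hpos : ∀ n (x : Chamber (n + 1)), 0 < harmonic rate (n + 1) x)
    (m : Chamber (N + 1) → ℝ) (x : GT (N + 1)) :
    gibbs rate m x = m (x.level (Fin.last N)) /
      harmonic rate (N + 1) (x.level (Fin.last N)) * weight rate x := by
  have h1 (k : Fin N) : levelKernel rate (x.level k.succ) (x.level k.castSucc) =
      harmonic rate ((k.castSucc : Fin (N + 1)) + 1) (x.level k.castSucc) /
        harmonic rate ((k.succ : Fin (N + 1)) + 1) (x.level k.succ) *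
          ∏ i, (rate ((x.level k.castSucc).pos i))⁻¹ := by
    rw [levelKernel]
    congr 1
    exact interlacingKernel_of_interlaces rate (x.interlaces k (Nat.succ_lt_succ k.2))
  have h2 := prod_div_telescope (fun k : Fin (N + 1) => harmonic rate (k + 1) (x.level k))
    fun k => (hpos k _).ne'
  have h3 : harmonic rate (((0 : Fin (N + 1)) : ℕ) + 1) (x.level 0) = 1 := rfl
  rw [gibbs, Finset.prod_congr rfl fun k _ => h1 k, Finset.prod_mul_distrib, h2, ← weight_eq, h3,
    one_div, ← mul_assoc, ← div_eq_mul_inv]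
  rfl

/-! ### Rates along a chain of pushes -/

open Classical in
theorem chain_prod_eq (rate : ℕ → ℝ) {x : GT N} {p q : Particle N} (h : Back x q p)
    (hp : ∀ r, ¬ DownStep x p r) :
    rate (x.pos p - 1) *
      ∏ r ∈ (Finset.univ.filter (Back x q)).erase q, rate (x.pos r) =
        ∏ r ∈ Finset.univ.filter (Back x q), rate (x.pos r - 1) := by
  induction h using Relation.ReflTransGen.head_induction_on with
  | refl =>
    have : Finset.univ.filter (Back x p) = {p} := by
      ext r
      simp only [Finset.mem_filter, Finset.mem_univ, true_and, Finset.mem_singleton]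
      constructor
      · intro h
        rcases Relation.ReflTransGen.cases_head h with h' | ⟨s, hs, -⟩
        · exact h'.symm
        · exact absurd hs (hp s)
      · rintro rfl
        exact Relation.ReflTransGen.refl
    simp [this]
  | @head q q0 h1 _ ih =>
    have hq : q ∉ Finset.univ.filter (Back x q0) := by
      simp only [Finset.mem_filter, Finset.mem_univ, true_and]
      intro h
      have := Back.level_le h
      have := h1.1.1
      omega
    have hS : Finset.univ.filter (Back x q) = insert q (Finset.univ.filter (Back x q0)) := by
      ext r
      simp only [Finset.mem_filter, Finset.mem_univ, true_and, Finset.mem_insert]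
      constructor
      · intro h
        rcases Relation.ReflTransGen.cases_head h with h' | ⟨s, hs, h'⟩
        · exact Or.inl h'.symm
        · rw [downStep_rightUnique x h1 hs]
          exact Or.inr h'
      · rintro (rfl | h)
        · exact Relation.ReflTransGen.refl
        · exact Relation.ReflTransGen.head h1 h
    have hq0 : q0 ∈ Finset.univ.filter (Back x q0) := by
      simp only [Finset.mem_filter, Finset.mem_univ, true_and]
      exact Relation.ReflTransGen.refl
    rw [hS, Finset.erase_insert hq, Finset.prod_insert hq, ← ih,
      ← Finset.mul_prod_erase _ _ hq0, ← h1.2, Nat.add_sub_cancel]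
    ring

-- Only the lowered particles below the top change their factor in the weight; cross-multiplying
-- avoids quotients of products.
open Classical in
theorem weight_pull_mul_prod {rate : ℕ → ℝ} (hrate : ∀ a, 0 < rate a) {x : GT (N + 1)}
    {q : Particle (N + 1)} (hq : Lowerable x q) :
    weight rate (pull x q hq) *
      ∏ r ∈ Finset.univ.filter (fun r => Back x q r ∧ (r.1 : ℕ) < N), rate (x.pos r - 1) =
    weight rate x *
      ∏ r ∈ Finset.univ.filter (fun r => Back x q r ∧ (r.1 : ℕ) < N), rate (x.pos r) := by
  rw [Finset.prod_filter, Finset.prod_filter, weight, weight, ← Finset.prod_mul_distrib,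
    ← Finset.prod_mul_distrib]
  refine Finset.prod_congr rfl fun r _ => ?_
  rw [GT.pos_pull]
  by_cases h1 : Back x q r <;> by_cases h2 : (r.1 : ℕ) < N
  · simp [h1, h2, (hrate _).ne']
  all_goals simp [h1, h2]

/-- Along a chain of pushes the rates cancel, except at the end of the chain. -/
theorem weight_pull {rate : ℕ → ℝ} (hrate : ∀ a, 0 < rate a) {x : GT (N + 1)}
    {q : Particle (N + 1)} (hq : Lowerable x q) :
    weight rate (pull x q hq) * rate ((pull x q hq).pos (start x q)) =
      weight rate x * if (q.1 : ℕ) < N then rate (x.pos q) else rate (x.pos q - 1) := by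
  classical
  have hC := chain_prod_eq rate (back_start x q) (not_downStep_start x q)
  have hW := weight_pull_mul_prod hrate hq
  have hqS : q ∈ Finset.univ.filter (Back x q) := by
    simp only [Finset.mem_filter, Finset.mem_univ, true_and]
    exact Relation.ReflTransGen.refl
  have hpos : (pull x q hq).pos (start x q) = x.pos (start x q) - 1 := by
    have := pos_pull_add_one hq (back_start x q)
    omega
  have hne (s : Finset (Particle (N + 1))) : ∏ r ∈ s, rate (x.pos r) ≠ 0 :=
    (Finset.prod_pos fun r _ => hrate _).ne'
  rw [hpos]
  -- The weight ignores the top level, so the end `q` of the chain contributes a factor to it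
  -- exactly when it lies below the top. In both cases `chain_prod_eq` cancels the rest of the
  -- chain.
  split_ifs with h
  · have hS : Finset.univ.filter (fun r : Particle (N + 1) => Back x q r ∧ (r.1 : ℕ) < N) =
        Finset.univ.filter (Back x q) := by
      refine Finset.filter_congr fun r _ => and_iff_left_of_imp fun hr => ?_
      have := hr.level_le
      omega
    rw [hS, ← hC, ← Finset.mul_prod_erase _ (fun r => rate (x.pos r)) hqS] at hW
    refine mul_right_cancel₀ (hne ((Finset.univ.filter (Back x q)).erase q)) ?_
    linear_combination hW
  · have hS : Finset.univ.filter (fun r : Particle (N + 1) => Back x q r ∧ (r.1 : ℕ) < N) =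
        (Finset.univ.filter (Back x q)).erase q := by
      ext r
      simp only [Finset.mem_filter, Finset.mem_univ, true_and, Finset.mem_erase]
      constructor
      · rintro ⟨h1, h2⟩
        refine ⟨?_, h1⟩
        rintro rfl
        exact h h2
      · rintro ⟨h1, h2⟩
        refine ⟨h2, ?_⟩
        rcases Relation.ReflTransGen.cases_head h2 with h' | ⟨s, hs, h'⟩
        · exact absurd h'.symm h1
        · have := Back.level_le h'
          have := hs.1.1
          have := q.1.2
          omega
    rw [hS] at hW
    rw [← Finset.mul_prod_erase _ (fun r => rate (x.pos r - 1)) hqS] at hC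
    refine mul_right_cancel₀ (hne ((Finset.univ.filter (Back x q)).erase q)) ?_
    linear_combination rate (x.pos q - 1) * hW + weight rate (pull x q hq) * hC

-- Each blocked particle is matched with its blocker, which has the same position and therefore the
-- same rate. The blockers are exactly the particles below the top level that cannot be lowered.
open Classical in
theorem sum_blocked_eq (rate : ℕ → ℝ) (x : GT (N + 1)) :
    ∑ p ∈ Finset.univ.filter (Blocked x), rate (x.pos p) =
      ∑ q ∈ Finset.univ.filter (fun q : Particle (N + 1) => (q.1 : ℕ) < N ∧ ¬ Lowerable x q),
        rate (x.pos q) := by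
  refine Finset.sum_bij (fun p hp => (Finset.mem_filter.1 hp).2.choose) (fun p hp => ?_)
    (fun p hp p' hp' h => ?_) (fun q hq => ?_) (fun p hp => ?_)
  · have h := (Finset.mem_filter.1 hp).2.choose_spec
    simp only [Finset.mem_filter, Finset.mem_univ, true_and]
    refine ⟨?_, fun hl => ?_⟩
    · have := h.1.1
      have := p.1.2
      omega
    · have := hl.above p h.1
      have := h.2
      omega
  · have h1 := (Finset.mem_filter.1 hp).2.choose_spec.1
    have h2 := (Finset.mem_filter.1 hp').2.choose_spec.1
    rw [← h] at h2
    exact h1.right_unique h2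
  · simp only [Finset.mem_filter, Finset.mem_univ, true_and] at hq
    obtain ⟨p, hp⟩ := Particle.exists_sameIndexAbove (p := q) (by omega)
    have hb : Blocked x p := by
      refine ⟨q, hp, ?_⟩
      have := x.pos_le hp
      by_contra hne
      exact hq.2 (Lowerable.of_above hp (by omega))
    have hb' : p ∈ Finset.univ.filter (Blocked x) := by simpa using hb
    exact ⟨p, hb', (Finset.mem_filter.1 hb').2.choose_spec.1.left_unique hp⟩
  · rw [(Finset.mem_filter.1 hp).2.choose_spec.2]

/-! ### Effect of a reversed move on the top level -/

/-- A reversed move that ends below the top level does not change the top level. -/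
theorem pull_level_last_of_lt {x : GT (N + 1)} {q : Particle (N + 1)} (hq : Lowerable x q)
    (h : (q.1 : ℕ) < N) : (pull x q hq).level (Fin.last N) = x.level (Fin.last N) := by
  refine Chamber.ext (funext fun i => pos_pull_of_not hq (r := ⟨Fin.last N, i⟩) fun hb => ?_)
  have := Back.level_le hb
  simp only [Fin.val_last] at this
  omega

theorem pull_level_last_pos {x : GT (N + 1)} {i : Fin (((Fin.last N : Fin (N + 1)) : ℕ) + 1)}
    (hq : Lowerable x ⟨Fin.last N, i⟩) :
    ((pull x ⟨Fin.last N, i⟩ hq).level (Fin.last N)).pos =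
      Function.update (x.level (Fin.last N)).pos i ((x.level (Fin.last N)).pos i - 1) := by
  funext j
  rw [Function.update_apply]
  split_ifs with h
  · subst h
    have h1 := pos_pull_add_one hq Relation.ReflTransGen.refl
    have h2 : x.pos ⟨Fin.last N, j⟩ = (x.level (Fin.last N)).pos j := rfl
    change (pull x ⟨Fin.last N, j⟩ hq).pos ⟨Fin.last N, j⟩ = _
    omega
  · refine pos_pull_of_not hq (r := ⟨Fin.last N, j⟩) fun hb => ?_
    rcases Relation.ReflTransGen.cases_head hb with h' | ⟨s, hs, h'⟩
    · simp only [Sigma.mk.injEq, heq_eq_eq, true_and] at h'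
      exact h h'.symm
    · have := Back.level_le h'
      have := hs.1.1
      simp only [Fin.val_last] at *
      omega

theorem pull_level_last_eq_iff (x : GT (N + 1)) (z : Chamber (N + 1)) (i : Fin (N + 1)) :
    (∃ hq : Lowerable x ⟨Fin.last N, i⟩, (pull x ⟨Fin.last N, i⟩ hq).level (Fin.last N) = z) ↔
      z.CanRaise i ∧ z.raise i = x.level (Fin.last N) := by
  constructor
  · rintro ⟨hq, rfl⟩
    have h0 : x.pos ⟨Fin.last N, i⟩ = (x.level (Fin.last N)).pos i := rfl
    have h1 := hq.one_le
    have hp := pull_level_last_pos hq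
    have hc : Chamber.CanRaise (n := N + 1)
        ((pull x ⟨Fin.last N, i⟩ hq).level (Fin.last N)) i := by
      intro j hij
      have : (x.level (Fin.last N)).pos i < (x.level (Fin.last N)).pos j :=
        (x.level (Fin.last N)).strictMono hij
      rw [hp]
      have e1 := Function.update_self i ((x.level (Fin.last N)).pos i - 1)
        (x.level (Fin.last N)).pos
      have e2 := Function.update_of_ne hij.ne' ((x.level (Fin.last N)).pos i - 1)
        (x.level (Fin.last N)).pos
      rw [e1, e2]
      omega
    refine ⟨hc, Chamber.ext ?_⟩
    rw [Chamber.raise_pos hc, hp]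
    funext j
    rcases eq_or_ne j i with rfl | hj
    · rw [Function.update_self]
      have e1 := Function.update_self j ((x.level (Fin.last N)).pos j - 1)
        (x.level (Fin.last N)).pos
      rw [e1]
      omega
    · rw [Function.update_of_ne hj]
      exact Function.update_of_ne hj _ _
  · rintro ⟨hc, hz⟩
    have hx : (x.level (Fin.last N)).pos = Function.update z.pos i (z.pos i + 1) := by
      rw [← hz]
      exact Chamber.raise_pos hc
    have hxi : x.pos ⟨Fin.last N, i⟩ = z.pos i + 1 := by
      change (x.level (Fin.last N)).pos i = _
      rw [hx]
      exact Function.update_self _ _ _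
    have hxj (j : Fin (N + 1)) (hj : j ≠ i) : x.pos ⟨Fin.last N, j⟩ = z.pos j := by
      change (x.level (Fin.last N)).pos j = _
      rw [hx]
      exact Function.update_of_ne hj _ _
    have hq : Lowerable x ⟨Fin.last N, i⟩ := by
      refine ⟨by omega, fun j hj => ?_, fun r hr => ?_⟩
      · have h1 := hxj j (ne_of_lt hj)
        have h2 := z.strictMono (show (j : Fin (N + 1)) < i from hj)
        change x.pos ⟨Fin.last N, j⟩ + 1 < _
        omega
      · have := hr.1
        have := r.1.2
        simp only [Fin.val_last] at *
        omega
    refine ⟨hq, Chamber.ext ?_⟩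
    rw [pull_level_last_pos hq]
    funext j
    rcases eq_or_ne j i with rfl | hj
    · refine (Function.update_self _ _ _).trans ?_
      change x.pos ⟨Fin.last N, j⟩ - 1 = _
      omega
    · exact (Function.update_of_ne hj _ _).trans (hxj j hj)

end Weight

/-! ### The action of the push-block generator on densities -/

section Dual

variable {N : ℕ} {rate : ℕ → ℝ} {M : ℝ}

/-- The action of the push-block generator on summable functions. -/
def pushBlockDual (N : ℕ) (hM : ∀ a, |rate a| ≤ M) : L1 (GT N) →L[ℝ] L1 (GT N) :=
  jumpDual (fun (p : Particle N) x => rate (x.pos p)) (fun p x => ring x p) M fun _ _ => hM _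

open Classical in
theorem pushBlockDual_dirac_apply (hM : ∀ a, |rate a| ≤ M) (w x : GT N) :
    pushBlockDual N hM (L1.dirac w) x =
      ∑ p, (if ∃ hp : ¬ Blocked w p, jump w p hp = x then rate (w.pos p) else 0) -
        if w = x then ∑ p ∈ Finset.univ.filter fun p => ¬ Blocked x p, rate (x.pos p) else 0 := by
  have h : (if w = x then ∑ p ∈ Finset.univ.filter fun p => ¬ Blocked x p, rate (x.pos p) else 0) =
      ∑ p, if w = x ∧ ¬ Blocked w p then rate (w.pos p) else 0 := by
    split_ifs with h
    · subst h
      rw [Finset.sum_filter]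
      simp
    · simp [h]
  rw [pushBlockDual, jumpDual_dirac, L1.apply_sum, h, ← Finset.sum_sub_distrib]
  refine Finset.sum_congr rfl fun p _ => ?_
  rw [L1.smul_apply, L1.sub_apply, L1.dirac_apply, L1.dirac_apply, ring]
  by_cases hp : Blocked w p
  · simp [hp]
  · have he : (∃ hp' : ¬ Blocked w p, jump w p hp' = x) ↔ jump w p hp = x :=
      ⟨fun ⟨_, h⟩ => h, fun h => ⟨hp, h⟩⟩
    rw [dif_neg hp, if_congr he rfl rfl, if_congr (and_iff_left hp) rfl rfl]
    split_ifs <;> ring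

-- The forward equation: gain from all predecessors minus the loss through unblocked jumps.
open Classical in
theorem pushBlockDual_apply (hM : ∀ a, |rate a| ≤ M) (ν : L1 (GT N)) (x : GT N) :
    pushBlockDual N hM ν x =
      ∑ q : {q // Lowerable x q}, ν (pull x q.1 q.2) * rate ((pull x q.1 q.2).pos (start x q.1)) -
        ν x * ∑ p ∈ Finset.univ.filter fun p => ¬ Blocked x p, rate (x.pos p) := by
  refine (L1.hasSum_apply_apply _ ν x).unique ?_
  simp only [pushBlockDual_dirac_apply, mul_sub]
  refine HasSum.sub ?_ ?_
  · have h1 := hasSum_fintype fun q : {q // Lowerable x q} =>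
      ν (pull x q.1 q.2) * rate ((pull x q.1 q.2).pos (start x q.1))
    set F : GT N × Particle N → ℝ := fun wp => ν wp.1 * rate (wp.1.pos wp.2) with hF
    set A : Set (GT N × Particle N) :=
      {wp | ∃ hp : ¬ Blocked wp.1 wp.2, jump wp.1 wp.2 hp = x} with hA
    have h2 : HasSum (fun wp : A => F wp) _ := (pullEquiv x).hasSum_iff.1 h1
    -- The gain is a sum over pairs of a predecessor and a ringing particle, which `pullEquiv`
    -- indexes by the finitely many lowerable particles.
    have h3 : HasSum (A.indicator F) _ := hasSum_subtype_iff_indicator.1 h2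
    refine h3.prod_fiberwise fun w => ?_
    rw [Finset.mul_sum]
    refine (hasSum_fintype _).congr_fun fun p => ?_
    rw [Set.indicator_apply]
    by_cases h : ∃ hp : ¬ Blocked w p, jump w p hp = x
    · rw [if_pos h, if_pos (show (w, p) ∈ A from h)]
    · rw [if_neg h, if_neg (show (w, p) ∉ A from h), mul_zero]
  · have := hasSum_single (f := fun w => ν w * if w = x then
      ∑ p ∈ Finset.univ.filter fun p => ¬ Blocked x p, rate (x.pos p) else 0) x
      fun w hw => by rw [if_neg hw, mul_zero]
    rwa [if_pos rfl] at this

open Classical in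
theorem sum_subtype_eq_sum_dite {ι : Type*} [Fintype ι] {P : ι → Prop} (f : ∀ i, P i → ℝ) :
    ∑ i : {i // P i}, f i.1 i.2 = ∑ i, if h : P i then f i h else 0 := by
  have h1 (i : {i // P i}) : f i.1 i.2 = (fun i => if h : P i then f i h else 0) i.1 :=
    (dif_pos i.2).symm
  rw [Finset.sum_congr rfl fun i _ => h1 i]
  rw [← Finset.sum_subtype (Finset.univ.filter P) (by simp) fun i => if h : P i then f i h else 0,
    Finset.sum_filter]
  refine Finset.sum_congr rfl fun i _ => ?_
  split_ifs <;> rfl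

theorem sum_particle_eq_add (f : Particle (N + 1) → ℝ) :
    ∑ q : Particle (N + 1), (if (q.1 : ℕ) < N then f q else 0) +
      ∑ i : Fin (N + 1), f ⟨Fin.last N, i⟩ = ∑ q, f q := by
  rw [Fintype.sum_sigma, Fintype.sum_sigma, Fin.sum_univ_castSucc,
    Fin.sum_univ_castSucc (n := N) fun k => ∑ i, f ⟨k, i⟩]
  simp

open Classical in
/-- The push-block generator applied to a Gibbs density. -/
theorem pushBlockDual_apply_of_weight (hrate : ∀ a, 0 < rate a) (hM : ∀ a, |rate a| ≤ M)
    {ν : L1 (GT (N + 1))} {c : ℝ} {z : Chamber (N + 1)}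
    (hν : ∀ x, ν x = if x.level (Fin.last N) = z then c * weight rate x else 0)
    (x : GT (N + 1)) :
    pushBlockDual (N + 1) hM ν x = c * weight rate x *
      (∑ i, (if z.CanRaise i ∧ z.raise i = x.level (Fin.last N) then rate (z.pos i) else 0) -
        if x.level (Fin.last N) = z then ∑ i, rate (z.pos i) else 0) := by
  -- By `weight_pull` every predecessor contributes the weight of `x` itself times a single rate,
  -- that of the end of the chain.
  have hterm (q : Particle (N + 1)) (hq : Lowerable x q) :
      ν (pull x q hq) * rate ((pull x q hq).pos (start x q)) = c * weight rate x *
        if (pull x q hq).level (Fin.last N) = z then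
          (if (q.1 : ℕ) < N then rate (x.pos q) else rate (x.pos q - 1)) else 0 := by
    rw [hν]
    by_cases h1 : (pull x q hq).level (Fin.last N) = z
    · rw [if_pos h1, if_pos h1, mul_assoc, weight_pull hrate hq, mul_assoc]
    · rw [if_neg h1, if_neg h1, zero_mul, mul_zero]
  have htop (i : Fin (N + 1)) : (if h : Lowerable x ⟨Fin.last N, i⟩ then
      (if (pull x _ h).level (Fin.last N) = z then rate (x.pos ⟨Fin.last N, i⟩ - 1) else 0)
        else 0) =
          if z.CanRaise i ∧ z.raise i = x.level (Fin.last N) then rate (z.pos i) else 0 := by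
    rw [if_congr (pull_level_last_eq_iff x z i).symm rfl rfl]
    by_cases h : Lowerable x ⟨Fin.last N, i⟩
    · rw [dif_pos h]
      by_cases hz : (pull x _ h).level (Fin.last N) = z
      · rw [if_pos hz, if_pos ⟨h, hz⟩]
        have h1 : (pull x _ h).pos ⟨Fin.last N, i⟩ = z.pos i := by
          rw [← hz]
          rfl
        have h2 := pos_pull_add_one h Relation.ReflTransGen.refl
        rw [← h2, h1, Nat.add_sub_cancel]
      · rw [if_neg hz, if_neg fun ⟨_, hz'⟩ => hz hz']
    · rw [dif_neg h, if_neg fun ⟨h', _⟩ => h h']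
  rw [pushBlockDual_apply, Finset.sum_congr rfl fun q _ => hterm q.1 q.2, ← Finset.mul_sum, hν,
    sum_subtype_eq_sum_dite (fun q h => if (pull x q h).level (Fin.last N) = z then
      (if (q.1 : ℕ) < N then rate (x.pos q) else rate (x.pos q - 1)) else 0),
    ← sum_particle_eq_add]
  simp only [Fin.val_last, lt_irrefl, if_false, htop]
  have hlow (q : Particle (N + 1)) : (if (q.1 : ℕ) < N then (if h : Lowerable x q then
      (if (pull x q h).level (Fin.last N) = z then
        (if (q.1 : ℕ) < N then rate (x.pos q) else rate (x.pos q - 1)) else 0) else 0) else 0) =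
      if x.level (Fin.last N) = z then
        (if (q.1 : ℕ) < N then (if Lowerable x q then rate (x.pos q) else 0) else 0) else 0 := by
    by_cases hN : (q.1 : ℕ) < N
    · by_cases h : Lowerable x q
      · simp only [hN, h, if_true, dif_pos, pull_level_last_of_lt h hN]
      · simp only [hN, h, if_true, dif_neg, if_false, ite_self, not_false_eq_true]
    · simp only [hN, if_false, ite_self]
  rw [Finset.sum_congr rfl fun q _ => hlow q]
  by_cases hz : x.level (Fin.last N) = z
  -- The gain from chains ending below the top is the sum of rates over lowerable particles there.
  -- The loss is the sum over unblocked particles. Since blocked and non-lowerable rates have equal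
  -- sums, the difference is minus the total rate of the top level.
  · have hA := sum_particle_eq_add fun q => rate (x.pos q)
    have hB := Finset.sum_filter_add_sum_filter_not Finset.univ (Blocked x) fun q => rate (x.pos q)
    rw [sum_blocked_eq, Finset.sum_filter] at hB
    have hC : ∑ q : Particle (N + 1), (if (q.1 : ℕ) < N then rate (x.pos q) else 0) =
        ∑ q : Particle (N + 1),
          (if (q.1 : ℕ) < N then (if Lowerable x q then rate (x.pos q) else 0) else 0) +
        ∑ q : Particle (N + 1), if (q.1 : ℕ) < N ∧ ¬ Lowerable x q then rate (x.pos q) else 0 := by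
      rw [← Finset.sum_add_distrib]
      refine Finset.sum_congr rfl fun q _ => ?_
      by_cases hN : (q.1 : ℕ) < N <;> by_cases h : Lowerable x q <;> simp [hN, h]
    have hD : ∑ i : Fin (N + 1), rate (x.pos ⟨Fin.last N, i⟩) = ∑ i, rate (z.pos i) := by
      rw [← hz]
      rfl
    simp only [hz, if_true]
    linear_combination c * weight rate x * (hA - hB - hC - hD)
  · simp only [hz, if_false, Finset.sum_const_zero, zero_mul, sub_zero, zero_add]

end Dual

/-! ### The kernels between levels -/

section Levels

variable {rate : ℕ → ℝ}

theorem finite_setOf_interlaces {n : ℕ} (x : Chamber (n + 1)) :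
    {y : Chamber n | Interlaces y x}.Finite := by
  have h : Set.InjOn Chamber.pos (Chamber.pos ⁻¹' Set.Icc 0 fun i : Fin n => x.pos i.succ) :=
    fun y _ y' _ h => Chamber.ext h
  refine ((Set.finite_Icc _ _).preimage h).subset fun y hy => ?_
  exact ⟨fun i => Nat.zero_le _, fun i => (hy i).2.le⟩

theorem interlacingKernel_nonneg (hrate : ∀ a, 0 < rate a) {n : ℕ} (x : Chamber (n + 1))
    (y : Chamber n) : 0 ≤ interlacingKernel rate x y := by
  rw [interlacingKernel]
  split_ifs
  · exact Finset.prod_nonneg fun i _ => (inv_pos.2 (hrate _)).le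
  · exact le_rfl

theorem summable_interlacingKernel_mul {n : ℕ} (x : Chamber (n + 1)) (f : Chamber n → ℝ) :
    Summable fun y => interlacingKernel rate x y * f y := by
  refine summable_of_hasFiniteSupport ((finite_setOf_interlaces x).subset fun y hy => ?_)
  by_contra h
  refine hy ?_
  simp only [interlacingKernel, if_neg (show ¬ Interlaces y x from h), zero_mul]

theorem harmonic_pos (hrate : ∀ a, 0 < rate a) (n : ℕ) (x : Chamber (n + 1)) :
    0 < harmonic rate (n + 1) x := by
  induction n with
  | zero => exact one_pos
  | succ n ih =>
    -- The configuration `x` without its last particle interlaces `x`, so the sum has a positive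
    -- term.
    let y : Chamber (n + 1) :=
      ⟨fun i => x.pos i.castSucc, fun i j hij => x.strictMono (Fin.castSucc_lt_castSucc_iff.2 hij)⟩
    have hy : Interlaces y x := fun i => ⟨le_rfl, x.strictMono (Fin.castSucc_lt_succ)⟩
    rw [harmonic]
    refine (summable_interlacingKernel_mul x _).tsum_pos
      (fun y => mul_nonneg (interlacingKernel_nonneg hrate x y) (ih y).le) y ?_
    rw [interlacingKernel_of_interlaces rate hy]
    exact mul_pos (Finset.prod_pos fun i _ => inv_pos.2 (hrate _)) (ih y)

theorem levelKernel_nonneg (hrate : ∀ a, 0 < rate a) {n : ℕ} (x : Chamber (n + 2))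
    (y : Chamber (n + 1)) : 0 ≤ levelKernel rate x y :=
  mul_nonneg (div_nonneg (harmonic_pos hrate _ _).le (harmonic_pos hrate _ _).le)
    (interlacingKernel_nonneg hrate x y)

theorem levelKernel_of_not (rate : ℕ → ℝ) {n : ℕ} {x : Chamber (n + 1)} {y : Chamber n}
    (h : ¬ Interlaces y x) : levelKernel rate x y = 0 := by
  rw [levelKernel, interlacingKernel, if_neg h, mul_zero]

theorem hasSum_levelKernel (hrate : ∀ a, 0 < rate a) {n : ℕ} (x : Chamber (n + 2)) :
    HasSum (fun y : Chamber (n + 1) => levelKernel rate x y) 1 := by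
  have h := ((summable_interlacingKernel_mul (rate := rate) x
    (harmonic rate (n + 1))).hasSum).div_const (harmonic rate (n + 2) x)
  have h0 := (harmonic_pos hrate (n + 1) x).ne'
  have h1 : harmonic rate (n + 2) x =
    ∑' y : Chamber (n + 1), interlacingKernel rate x y * harmonic rate (n + 1) y := by rw [harmonic]
  rw [← h1, div_self h0] at h
  refine h.congr_fun fun y => ?_
  rw [levelKernel]
  ring

theorem L1.norm_le_one_of_hasSum {S : Type*} {f : S → ℝ} (h0 : ∀ x, 0 ≤ f x) (h : HasSum f 1) :
    ‖L1.ofSummable f h.summable‖ ≤ 1 := by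
  rw [L1.norm_eq]
  refine le_of_eq (Eq.trans (tsum_congr fun x => ?_) h.tsum_eq)
  rw [L1.ofSummable_apply, Real.norm_of_nonneg (h0 x)]

/-- The Markov kernel from level `n + 2` to level `n + 1` as an operator. -/
def levelOp (hrate : ∀ a, 0 < rate a) (n : ℕ) :
    L1 (Chamber (n + 2)) →L[ℝ] L1 (Chamber (n + 1)) :=
  L1.lift (fun x => L1.ofSummable _ (hasSum_levelKernel hrate x).summable) 1 fun x =>
    L1.norm_le_one_of_hasSum (levelKernel_nonneg hrate x) (hasSum_levelKernel hrate x)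

theorem levelOp_dirac_apply (hrate : ∀ a, 0 < rate a) {n : ℕ} (x : Chamber (n + 2))
    (y : Chamber (n + 1)) : levelOp hrate n (L1.dirac x) y = levelKernel rate x y := by
  rw [levelOp, L1.lift_dirac, L1.ofSummable_apply]

/-! ### Forgetting the top level -/

/-- The pattern without its top level. -/
def GT.dropTop {N : ℕ} (x : GT (N + 1)) : GT N where
  level k := x.level k.castSucc
  interlaces k hk := x.interlaces k (Nat.lt_succ_of_lt hk)

/-- A family of levels with one level added. -/
def snocLevel {n : ℕ} (f : (k : Fin n) → Chamber ((k : ℕ) + 1)) (z : Chamber (n + 1)) :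
    (k : Fin (n + 1)) → Chamber ((k : ℕ) + 1) :=
  Fin.lastCases (motive := fun k : Fin (n + 1) => Chamber ((k : ℕ) + 1)) z fun k => f k

theorem snocLevel_last {n : ℕ} (f : (k : Fin n) → Chamber ((k : ℕ) + 1)) (z : Chamber (n + 1)) :
    snocLevel f z (Fin.last n) = z :=
  Fin.lastCases_last (motive := fun k : Fin (n + 1) => Chamber ((k : ℕ) + 1))

theorem snocLevel_castSucc {n : ℕ} (f : (k : Fin n) → Chamber ((k : ℕ) + 1)) (z : Chamber (n + 1))
    (k : Fin n) : snocLevel f z k.castSucc = f k :=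
  Fin.lastCases_castSucc (motive := fun k : Fin (n + 1) => Chamber ((k : ℕ) + 1)) k

/-- The pattern with a new top level. -/
def GT.extend {N : ℕ} (x : GT (N + 1)) (z : Chamber (N + 2))
    (h : Interlaces (x.level (Fin.last N)) z) : GT (N + 2) where
  level := snocLevel x.level z
  interlaces := by
    intro k hk
    have h1 : snocLevel x.level z ⟨k, Nat.lt_of_succ_lt hk⟩ = x.level ⟨k, by omega⟩ :=
      snocLevel_castSucc x.level z ⟨k, by omega⟩
    rcases Nat.lt_or_ge (k + 1) (N + 1) with hk' | hk'
    · have h2 : snocLevel x.level z ⟨k + 1, hk⟩ = x.level ⟨k + 1, hk'⟩ :=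
        snocLevel_castSucc x.level z ⟨k + 1, hk'⟩
      rw [h1, h2]
      exact x.interlaces k hk'
    · obtain rfl : k = N := by omega
      have h2 : snocLevel x.level z ⟨k + 1, hk⟩ = z := snocLevel_last x.level z
      rw [h1, h2]
      exact h

theorem GT.extend_level_last {N : ℕ} (x : GT (N + 1)) (z : Chamber (N + 2))
    (h : Interlaces (x.level (Fin.last N)) z) : (x.extend z h).level (Fin.last (N + 1)) = z :=
  snocLevel_last ..

theorem GT.dropTop_extend {N : ℕ} (x : GT (N + 1)) (z : Chamber (N + 2))
    (h : Interlaces (x.level (Fin.last N)) z) : (x.extend z h).dropTop = x :=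
  GT.ext (funext fun k => snocLevel_castSucc x.level z k)

theorem GT.interlaces_dropTop {N : ℕ} (x : GT (N + 2)) :
    Interlaces (x.dropTop.level (Fin.last N)) (x.level (Fin.last (N + 1))) :=
  x.interlaces N (Nat.lt_succ_self _)

theorem GT.ext_dropTop {N : ℕ} {x y : GT (N + 1)} (h1 : x.dropTop = y.dropTop)
    (h2 : x.level (Fin.last N) = y.level (Fin.last N)) : x = y := by
  refine GT.ext (funext fun k => ?_)
  refine Fin.lastCases h2 (fun k => ?_) k
  exact congrFun (congrArg GT.level h1) k

/-! ### Gibbs densities as an operator -/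

theorem gibbs_succ {N : ℕ} (m : Chamber (N + 2) → ℝ) (x : GT (N + 2)) :
    gibbs rate m x = m (x.level (Fin.last (N + 1))) *
      gibbs rate (levelKernel rate (x.level (Fin.last (N + 1)))) x.dropTop := by
  rw [gibbs, gibbs, Fin.prod_univ_castSucc, mul_comm (∏ _, _)]
  rfl

theorem gibbs_nonneg (hrate : ∀ a, 0 < rate a) {N : ℕ} {m : Chamber (N + 1) → ℝ}
    (hm : ∀ z, 0 ≤ m z) (x : GT (N + 1)) : 0 ≤ gibbs rate m x := by
  rw [gibbs_eq (harmonic_pos hrate)]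
  exact mul_nonneg (div_nonneg (hm _) (harmonic_pos hrate _ _).le) (weight_pos hrate x).le

open Classical in
theorem L1.dirac_nonneg {S : Type*} (x y : S) : 0 ≤ L1.dirac x y := by
  rw [L1.dirac_apply]
  split_ifs <;> simp

/-- The operator that maps a density on the top level to the Gibbs density. -/
def gibbsLift (hrate : ∀ a, 0 < rate a) {N : ℕ}
    (h : ∀ z : Chamber (N + 1), HasSum (gibbs rate (L1.dirac z)) 1) :
    L1 (Chamber (N + 1)) →L[ℝ] L1 (GT (N + 1)) :=
  L1.lift (fun z => L1.ofSummable _ (h z).summable) 1 fun z =>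
    L1.norm_le_one_of_hasSum (gibbs_nonneg hrate (L1.dirac_nonneg z)) (h z)

theorem gibbsLift_apply (hrate : ∀ a, 0 < rate a) {N : ℕ}
    (h : ∀ z : Chamber (N + 1), HasSum (gibbs rate (L1.dirac z)) 1)
    (m : L1 (Chamber (N + 1))) (x : GT (N + 1)) : gibbsLift hrate h m x = gibbs rate m x := by
  refine (L1.hasSum_apply_apply _ m x).unique ?_
  have h1 (z : Chamber (N + 1)) : m z * gibbsLift hrate h (L1.dirac z) x =
      m z * gibbs rate (L1.dirac z) x := by
    rw [gibbsLift, L1.lift_dirac, L1.ofSummable_apply]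
  simp only [h1]
  have h2 := hasSum_single (f := fun z => m z * gibbs rate (L1.dirac z) x) (x.level (Fin.last N))
    fun z hz => by rw [gibbs, L1.dirac_ne hz, zero_mul, mul_zero]
  convert h2 using 1
  rw [gibbs, gibbs, L1.dirac_self, one_mul]

theorem mass_gibbsLift (hrate : ∀ a, 0 < rate a) {N : ℕ}
    (h : ∀ z : Chamber (N + 1), HasSum (gibbs rate (L1.dirac z)) 1)
    (m : L1 (Chamber (N + 1))) : L1.mass (gibbsLift hrate h m) = L1.mass m := by
  have h1 : L1.mass.comp (gibbsLift hrate h) = L1.mass := by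
    refine L1.clm_ext fun z => ?_
    rw [ContinuousLinearMap.comp_apply, L1.mass_dirac, gibbsLift, L1.lift_dirac, L1.mass_apply]
    exact (h z).tsum_eq
  exact congrArg (fun T => T m) h1

/-- Patterns with top `z` are the extensions of smaller patterns whose top interlaces `z`, and their
density is the smaller Gibbs density built on `levelKernel rate z`. The induction hypothesis and the
normalisation of the kernel give mass one; `gibbsLift` carries summability as a hypothesis for the
sake of this induction. -/
theorem hasSum_gibbs_dirac (hrate : ∀ a, 0 < rate a) (N : ℕ) (z : Chamber (N + 1)) :
    HasSum (gibbs rate (L1.dirac z)) 1 := by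
  induction N with
  | zero =>
    let x : GT 1 := ⟨snocLevel (fun k : Fin 0 => k.elim0) z, fun k hk => by omega⟩
    have hx : x.level (Fin.last 0) = z := snocLevel_last ..
    have h := hasSum_single (f := gibbs rate (L1.dirac z)) x fun y hy => by
      rw [gibbs, L1.dirac_ne, zero_mul]
      intro h
      refine hy (GT.ext_dropTop (GT.ext (funext fun k => k.elim0)) ?_)
      rw [hx, h]
    convert h using 1
    rw [gibbs, hx, L1.dirac_self]
    simp
  | succ N ih =>
    have h1 : HasSum (fun x => gibbs rate (levelKernel rate z) x) 1 := by
      have h := L1.hasSum_mass (gibbsLift hrate ih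
        (L1.ofSummable _ (hasSum_levelKernel hrate z).summable))
      rw [mass_gibbsLift, L1.mass_apply] at h
      simp only [L1.ofSummable_apply, (hasSum_levelKernel hrate z).tsum_eq, gibbsLift_apply] at h
      exact h
    let A : Set (GT (N + 1)) := {x | Interlaces (x.level (Fin.last N)) z}
    let e : A → GT (N + 2) := fun x => x.1.extend z x.2
    have he : Function.Injective e := fun x y h => by
      have := congrArg GT.dropTop h
      simp only [e, GT.dropTop_extend] at this
      exact Subtype.ext this
    refine (he.hasSum_iff fun x hx => ?_).1 ?_
    · rw [gibbs, L1.dirac_ne, zero_mul]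
      rintro rfl
      refine hx ⟨⟨x.dropTop, x.interlaces_dropTop⟩, ?_⟩
      exact GT.ext_dropTop (GT.dropTop_extend ..) (GT.extend_level_last ..)
    · have h2 : (gibbs rate (L1.dirac z) ∘ e) =
          (fun x => gibbs rate (levelKernel rate z) x) ∘ ((↑) : A → GT (N + 1)) := by
        funext x
        simp only [Function.comp_apply, e]
        rw [gibbs_succ, GT.extend_level_last, GT.dropTop_extend, L1.dirac_self, one_mul]
      rw [h2]
      refine (hasSum_subtype_iff_of_support_subset fun x hx => ?_).2 h1
      by_contra h
      refine hx ?_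
      simp only [gibbs]
      rw [levelKernel_of_not rate h, zero_mul]

/-- The operator that maps a density on the top level to the Gibbs density. -/
def gibbsOp (hrate : ∀ a, 0 < rate a) (N : ℕ) : L1 (Chamber (N + 1)) →L[ℝ] L1 (GT (N + 1)) :=
  gibbsLift hrate (hasSum_gibbs_dirac hrate N)

theorem gibbsOp_apply (hrate : ∀ a, 0 < rate a) {N : ℕ} (m : L1 (Chamber (N + 1)))
    (x : GT (N + 1)) : gibbsOp hrate N m x = gibbs rate m x := gibbsLift_apply ..

theorem mass_gibbsOp (hrate : ∀ a, 0 < rate a) {N : ℕ} (m : L1 (Chamber (N + 1))) :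
    L1.mass (gibbsOp hrate N m) = L1.mass m := mass_gibbsLift ..

/-- Gibbs laws are consistent: given the top level, a smaller pattern has at most one extension, so
forgetting the top replaces `m` by its image under the level kernel. -/
theorem map_dropTop_gibbsOp (hrate : ∀ a, 0 < rate a) {N : ℕ} (m : L1 (Chamber (N + 2))) :
    L1.map GT.dropTop (gibbsOp hrate (N + 1) m) = gibbsOp hrate N (levelOp hrate N m) := by
  suffices h : (L1.map GT.dropTop).comp (gibbsOp hrate (N + 1)) =
      (gibbsOp hrate N).comp (levelOp hrate N) from congrArg (fun T => T m) h
  refine L1.clm_ext fun z => ?_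
  ext x
  rw [ContinuousLinearMap.comp_apply, ContinuousLinearMap.comp_apply, gibbsOp_apply, L1.map_apply]
  refine (L1.hasSum_mass _).unique ?_
  have h0 (y : GT (N + 2)) :
      L1.restr (GT.dropTop ⁻¹' {x}) (gibbsOp hrate (N + 1) (L1.dirac z)) y ≠ 0 →
      y.dropTop = x ∧ y.level (Fin.last (N + 1)) = z := by
    intro h
    rw [L1.restr_apply, gibbsOp_apply] at h
    refine ⟨?_, ?_⟩
    · by_contra h'
      exact h (if_neg h')
    · by_contra h'
      rw [gibbs, L1.dirac_ne (Ne.symm h'), zero_mul, ite_self] at h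
      exact h rfl
  by_cases hx : Interlaces (x.level (Fin.last N)) z
  · have h := hasSum_single (f := fun y =>
      L1.restr (GT.dropTop ⁻¹' {x}) (gibbsOp hrate (N + 1) (L1.dirac z)) y)
      (x.extend z hx) fun y hy => by
        by_contra h
        obtain ⟨h1, h2⟩ := h0 y h
        refine hy (GT.ext_dropTop ?_ ?_)
        · rw [h1, GT.dropTop_extend]
        · rw [h2, GT.extend_level_last]
    convert h using 1
    rw [L1.restr_apply, if_pos (show x.extend z hx ∈ GT.dropTop ⁻¹' {x} from GT.dropTop_extend ..),
      gibbsOp_apply, gibbs_succ, GT.extend_level_last, GT.dropTop_extend, L1.dirac_self, one_mul,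
      gibbs, gibbs, levelOp_dirac_apply]
  · have h1 : gibbs rate (levelOp hrate N (L1.dirac z)) x = 0 := by
      rw [gibbs, levelOp_dirac_apply, levelKernel_of_not rate hx, zero_mul]
    rw [h1]
    refine hasSum_zero.congr_fun fun y => ?_
    by_contra h
    obtain ⟨h1, h2⟩ := h0 y h
    subst h1 h2
    exact hx y.interlaces_dropTop

end Levels

/-! ### Harmonicity and the intertwining with the push-block generator -/

section Intertwining

variable {rate : ℕ → ℝ} {M : ℝ}

theorem mass_jumpDual {S J : Type*} [Fintype J] {r : J → S → ℝ} {τ : J → S → S} {C : ℝ}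
    (hr : ∀ j x, |r j x| ≤ C) (ν : L1 S) : L1.mass (jumpDual r τ C hr ν) = 0 := by
  have h : L1.mass.comp (jumpDual r τ C hr) = 0 := L1.clm_ext fun x => by simp
  exact congrArg (fun T => T ν) h

open Classical in
theorem gibbsOp_dirac_apply (hrate : ∀ a, 0 < rate a) {N : ℕ} (z : Chamber (N + 1))
    (x : GT (N + 1)) : gibbsOp hrate N (L1.dirac z) x =
      if x.level (Fin.last N) = z then (harmonic rate (N + 1) z)⁻¹ * weight rate x else 0 := by
  rw [gibbsOp_apply, gibbs_eq (harmonic_pos hrate)]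
  split_ifs with h
  · rw [h, L1.dirac_self, one_div]
  · rw [L1.dirac_ne (Ne.symm h), zero_div, zero_mul]

-- Unfolds the recursion for `harmonic`: it is the partition function of the patterns below `z`.
open Classical in
theorem hasSum_weight (hrate : ∀ a, 0 < rate a) {N : ℕ} (z : Chamber (N + 1)) :
    HasSum (fun x : GT (N + 1) => if x.level (Fin.last N) = z then weight rate x else 0)
      (harmonic rate (N + 1) z) := by
  have h := (L1.hasSum_mass (gibbsOp hrate N (L1.dirac z))).mul_left (harmonic rate (N + 1) z)
  rw [mass_gibbsOp, L1.mass_dirac, mul_one] at h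
  refine h.congr_fun fun x => ?_
  rw [gibbsOp_dirac_apply]
  split_ifs
  · rw [mul_inv_cancel_left₀ (harmonic_pos hrate _ _).ne']
  · rw [mul_zero]

/-- The push-block generator produces no mass. Summing its action on the Gibbs density over `z`
turns every weight sum into a value of `harmonic`, and the vanishing total is the harmonicity at
`z`. -/
theorem killedGenerator_harmonic (hrate : ∀ a, 0 < rate a) (hM : ∀ a, |rate a| ≤ M) {N : ℕ}
    (z : Chamber (N + 1)) : killedGenerator rate (harmonic rate (N + 1)) z = 0 := by
  classical
  have h1 := L1.hasSum_mass (pushBlockDual (N + 1) hM (gibbsOp hrate N (L1.dirac z)))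
  rw [show L1.mass (pushBlockDual (N + 1) hM (gibbsOp hrate N (L1.dirac z))) = 0 from
    mass_jumpDual _ _] at h1
  simp only [pushBlockDual_apply_of_weight hrate hM (gibbsOp_dirac_apply hrate z)] at h1
  have h2 : HasSum (fun x : GT (N + 1) => (harmonic rate (N + 1) z)⁻¹ * weight rate x *
      (∑ i, (if z.CanRaise i ∧ z.raise i = x.level (Fin.last N) then rate (z.pos i) else 0) -
        if x.level (Fin.last N) = z then ∑ i, rate (z.pos i) else 0))
      ((harmonic rate (N + 1) z)⁻¹ * killedGenerator rate (harmonic rate (N + 1)) z) := by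
    have h3 : HasSum (fun x : GT (N + 1) => ∑ i, rate (z.pos i) *
        ((if z.CanRaise i then
          (if x.level (Fin.last N) = z.raise i then weight rate x else 0) else 0) -
          if x.level (Fin.last N) = z then weight rate x else 0))
        (killedGenerator rate (harmonic rate (N + 1)) z) := by
      refine hasSum_sum fun i _ => HasSum.mul_left _ (HasSum.sub ?_ (hasSum_weight hrate z))
      split_ifs
      · exact hasSum_weight hrate _
      · exact hasSum_zero
    refine (h3.mul_left _).congr_fun fun x => ?_
    rw [mul_assoc]
    congr 1
    have h4 : (if x.level (Fin.last N) = z then ∑ i, rate (z.pos i) else 0) =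
        ∑ i, if x.level (Fin.last N) = z then rate (z.pos i) else 0 := by
      split_ifs <;> simp
    rw [h4, ← Finset.sum_sub_distrib, Finset.mul_sum]
    refine Finset.sum_congr rfl fun i _ => ?_
    rw [if_congr (eq_comm (a := x.level (Fin.last N)) (b := z.raise i)) rfl rfl, ite_and]
    split_ifs <;> ring
  have h5 := h1.unique h2
  have := (harmonic_pos hrate N z).ne'
  simpa [this] using h5.symm

theorem levelRate_nonneg (hrate : ∀ a, 0 < rate a) {N : ℕ} (i : Fin (N + 1))
    (x : Chamber (N + 1)) : 0 ≤ levelRate rate i x := by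
  rw [levelRate]
  split_ifs
  · exact mul_nonneg (hrate _).le
      (div_nonneg (harmonic_pos hrate _ _).le (harmonic_pos hrate _ _).le)
  · exact le_rfl

theorem sum_levelRate (hrate : ∀ a, 0 < rate a) (hM : ∀ a, |rate a| ≤ M) {N : ℕ}
    (x : Chamber (N + 1)) : ∑ i, levelRate rate i x = ∑ i, rate (x.pos i) := by
  have h := killedGenerator_harmonic hrate hM x
  have h0 := (harmonic_pos hrate N x).ne'
  have h1 : (∑ i, levelRate rate i x - ∑ i, rate (x.pos i)) * harmonic rate (N + 1) x =
      killedGenerator rate (harmonic rate (N + 1)) x := by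
    rw [killedGenerator, ← Finset.sum_sub_distrib, Finset.sum_mul]
    refine Finset.sum_congr rfl fun i _ => ?_
    rw [levelRate]
    split_ifs
    · field_simp
    · ring
  rw [h] at h1
  exact sub_eq_zero.1 ((mul_eq_zero.1 h1).resolve_right h0)

/-- The ratio of `harmonic` values in a single rate is not bounded beforehand; harmonicity makes the
rates sum to that of the untransformed chains, which is bounded. -/
theorem levelRate_le (hrate : ∀ a, 0 < rate a) (hM : ∀ a, |rate a| ≤ M) {N : ℕ} (i : Fin (N + 1))
    (x : Chamber (N + 1)) : levelRate rate i x ≤ ∑ _i : Fin (N + 1), M := by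
  refine (Finset.single_le_sum (fun j _ => levelRate_nonneg hrate j x) (Finset.mem_univ i)).trans ?_
  rw [sum_levelRate hrate hM]
  exact Finset.sum_le_sum fun j _ => (le_abs_self _).trans (hM _)

theorem abs_levelRate_le (hrate : ∀ a, 0 < rate a) (hM : ∀ a, |rate a| ≤ M) {N : ℕ}
    (i : Fin (N + 1)) (x : Chamber (N + 1)) : |levelRate rate i x| ≤ ∑ _i : Fin (N + 1), M := by
  rw [abs_of_nonneg (levelRate_nonneg hrate i x)]
  exact levelRate_le hrate hM i x

/-- The action of the generator of a level on summable functions. -/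
def levelDual (hrate : ∀ a, 0 < rate a) (hM : ∀ a, |rate a| ≤ M) (N : ℕ) :
    L1 (Chamber (N + 1)) →L[ℝ] L1 (Chamber (N + 1)) :=
  jumpDual (levelRate rate) (fun i x => x.raise i) _ (abs_levelRate_le hrate hM)

/-- On a point mass at `z` both sides give the surviving top-level expression; the ratio in the
Doob-transformed rate absorbs the change of normalisation from `z` to the new top `y`. -/
theorem gibbsOp_comp_levelDual (hrate : ∀ a, 0 < rate a) (hM : ∀ a, |rate a| ≤ M) (N : ℕ) :
    (gibbsOp hrate N).comp (levelDual hrate hM N) =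
      (pushBlockDual (N + 1) hM).comp (gibbsOp hrate N) := by
  classical
  refine L1.clm_ext fun z => ?_
  ext x
  rw [ContinuousLinearMap.comp_apply, ContinuousLinearMap.comp_apply,
    pushBlockDual_apply_of_weight hrate hM (gibbsOp_dirac_apply hrate z), gibbsOp_apply,
    gibbs_eq (harmonic_pos hrate), levelDual, jumpDual_dirac, L1.apply_sum]
  set y := x.level (Fin.last N) with hy
  have hz := (harmonic_pos hrate N z).ne'
  have hyy := (harmonic_pos hrate N y).ne'
  have h1 (i : Fin (N + 1)) : levelRate rate i z * L1.dirac (z.raise i) y =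
      (harmonic rate (N + 1) z)⁻¹ * harmonic rate (N + 1) y *
        if z.CanRaise i ∧ z.raise i = y then rate (z.pos i) else 0 := by
    by_cases h : z.raise i = y
    · by_cases hc : z.CanRaise i
      · rw [h, L1.dirac_self, if_pos ⟨hc, rfl⟩, levelRate, if_pos hc, h]
        field_simp
      · rw [levelRate, if_neg hc, if_neg fun h => hc h.1, zero_mul, mul_zero]
    · rw [L1.dirac_ne h, if_neg fun h' => h h'.2, mul_zero, mul_zero]
  have h2 : ∑ i, (levelRate rate i z • (L1.dirac (z.raise i) - L1.dirac z) : L1 _) y =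
      (harmonic rate (N + 1) z)⁻¹ * harmonic rate (N + 1) y *
        (∑ i, (if z.CanRaise i ∧ z.raise i = y then rate (z.pos i) else 0) -
          if y = z then ∑ i, rate (z.pos i) else 0) := by
    simp only [L1.smul_apply, L1.sub_apply, mul_sub, h1, Finset.sum_sub_distrib, ← Finset.mul_sum,
      ← Finset.sum_mul, sum_levelRate hrate hM]
    congr 1
    split_ifs with h
    · rw [h, L1.dirac_self, mul_one, inv_mul_cancel₀ hz, one_mul]
    · rw [L1.dirac_ne (Ne.symm h), mul_zero, mul_zero]
  refine (congrArg (fun a => a / harmonic rate (N + 1) y * weight rate x) h2).trans ?_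
  field_simp

theorem isMarkovSemigroup_levelSemigroup (hrate : UB rate) (N : ℕ) :
    IsMarkovSemigroup fun t (x y : Chamber (N + 1)) => levelSemigroup rate t x y := by
  obtain ⟨s, M, hs, hM⟩ := id hrate
  have hpos (a : ℕ) : 0 < rate a := hs.trans_le (hM a).1
  have habs (a : ℕ) : |rate a| ≤ M := by rw [abs_of_pos (hpos a)]; exact (hM a).2
  have h : (fun t (x y : Chamber (N + 1)) => levelSemigroup rate t x y) =
      expKernel (levelGenerator rate) := by
    funext t x y
    exact levelSemigroup_eq_expKernel hrate (harmonic_pos hpos N)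
      (killedGenerator_harmonic hpos habs) t x y
  rw [h]
  exact isMarkovSemigroup_jumpGenerator (levelRate_nonneg hpos) (levelRate_le hpos habs)

theorem levelSemigroup_eq_exp (hrate : UB rate) (hpos : ∀ a, 0 < rate a)
    (hM : ∀ a, |rate a| ≤ M) {N : ℕ} (t : ℝ) (x y : Chamber (N + 1)) :
    NormedSpace.exp (t • levelDual hpos hM N) (L1.dirac x) y = levelSemigroup rate t x y := by
  rw [levelSemigroup_eq_expKernel hrate (harmonic_pos hpos N)
      (killedGenerator_harmonic hpos hM) t x y]
  exact (expKernel_jumpGenerator _ t x y).symm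

theorem expKernel_pushBlockGenerator (hM : ∀ a, |rate a| ≤ M) {N : ℕ} (t : ℝ) (x y : GT N) :
    NormedSpace.exp (t • pushBlockDual N hM) (L1.dirac x) y =
      expKernel (pushBlockGenerator rate) t x y :=
  (expKernel_jumpGenerator _ t x y).symm

end Intertwining

/-! ### The dynamics of the lower levels -/

section Lumping

variable {N : ℕ}

/-- A particle of a pattern without top level, as a particle of the whole pattern. -/
def Particle.up (p : Particle N) : Particle (N + 1) := ⟨p.1.castSucc, p.2⟩

theorem GT.dropTop_pos (x : GT (N + 1)) (p : Particle N) : x.dropTop.pos p = x.pos p.up := rfl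

theorem Particle.exists_up {q : Particle (N + 1)} (h : (q.1 : ℕ) < N) :
    ∃ p : Particle N, p.up = q :=
  ⟨⟨⟨q.1, h⟩, q.2⟩, rfl⟩

theorem blocked_up_iff (x : GT (N + 1)) (p : Particle N) :
    Blocked x p.up ↔ Blocked x.dropTop p := by
  constructor
  · rintro ⟨q, hq, h⟩
    have h1 : (p.1 : ℕ) = q.1 + 1 := hq.1
    obtain ⟨q, rfl⟩ := Particle.exists_up (q := q) (by have := p.1.2; omega)
    exact ⟨q, hq, h⟩
  · rintro ⟨q, hq, h⟩
    exact ⟨q.up, hq, h⟩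

theorem Particle.up_injective : Function.Injective (Particle.up (N := N)) := fun _ _ h =>
  Particle.ext_val (congrArg (fun r : Particle (N + 1) => (r.1 : ℕ)) h)
    (congrArg (fun r : Particle (N + 1) => (r.2 : ℕ)) h)

theorem moves_up_iff (x : GT (N + 1)) (p q : Particle N) :
    Moves x p.up q.up ↔ Moves x.dropTop p q := by
  constructor
  · intro h
    -- The induction runs over all particles of the larger pattern, since intermediate members of
    -- the chain are not known beforehand to lie below the top; they do, because pushes go up one
    -- level at a time.
    have key (r : Particle (N + 1)) (hr : Moves x p.up r) :
        ∀ q : Particle N, q.up = r → Moves x.dropTop p q := by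
      induction hr with
      | self =>
        intro q hq
        rw [Particle.up_injective hq]
        exact Moves.self
      | push r r' _ hn hb ih =>
        rintro q rfl
        have h1 : (q.1 : ℕ) = r.1 + 1 := hn.1
        obtain ⟨r, rfl⟩ := Particle.exists_up (q := r) (by have := q.1.2; omega)
        exact Moves.push r q (ih r rfl) hn hb
    exact key _ h q rfl
  · intro h
    induction h with
    | self => exact Moves.self
    | push r r' _ hn hb ih => exact Moves.push r.up r'.up ih hn hb

theorem Moves.level_le {x : GT N} {p q : Particle N} (h : Moves x p q) : (p.1 : ℕ) ≤ q.1 := by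
  induction h with
  | self => exact le_rfl
  | push r r' _ hn _ ih =>
    have := hn.1
    omega

theorem dropTop_ring_up (x : GT (N + 1)) (p : Particle N) :
    (ring x p.up).dropTop = ring x.dropTop p := by
  classical
  rw [ring, ring]
  by_cases h : Blocked x p.up
  · rw [dif_pos h, dif_pos ((blocked_up_iff x p).1 h)]
  · rw [dif_neg h, dif_neg (mt (blocked_up_iff x p).2 h)]
    refine GT.ext_pos fun q => ?_
    rw [GT.dropTop_pos, GT.pos_jump, GT.pos_jump, if_congr (moves_up_iff x p q) rfl rfl,
      GT.dropTop_pos]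

theorem dropTop_ring_last (x : GT (N + 1)) (i : Fin (((Fin.last N : Fin (N + 1)) : ℕ) + 1)) :
    (ring x ⟨Fin.last N, i⟩).dropTop = x.dropTop := by
  classical
  rw [ring]
  split_ifs with h
  · rfl
  · refine GT.ext_pos fun q => ?_
    rw [GT.dropTop_pos, GT.pos_jump, if_neg, GT.dropTop_pos, Nat.add_zero]
    intro hm
    have h1 := hm.level_le
    have h2 := q.1.2
    simp only [Particle.up, Fin.val_last, Fin.val_castSucc] at h1
    omega

/-- Blocking and pushing act only from lower to higher levels, so top-level rings are invisible
after dropping the top and the other rings act as in the smaller pattern. -/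
theorem map_dropTop_comp_pushBlockDual {rate : ℕ → ℝ} {M : ℝ} (hM : ∀ a, |rate a| ≤ M) :
    (L1.map GT.dropTop).comp (pushBlockDual (N + 1) hM) =
      (pushBlockDual N hM).comp (L1.map GT.dropTop) := by
  refine L1.clm_ext fun x => ?_
  rw [ContinuousLinearMap.comp_apply, ContinuousLinearMap.comp_apply, L1.map_dirac, pushBlockDual,
    pushBlockDual, jumpDual_dirac, jumpDual_dirac, map_sum]
  simp only [map_smul, map_sub, L1.map_dirac]
  rw [Fintype.sum_sigma, Fintype.sum_sigma, Fin.sum_univ_castSucc]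
  simp only [dropTop_ring_last, sub_self, smul_zero, Finset.sum_const_zero, add_zero]
  refine Finset.sum_congr rfl fun k _ => Finset.sum_congr rfl fun i _ => ?_
  rw [← dropTop_ring_up]
  rfl

end Lumping

/-! ### The main result -/

instance (n : ℕ) : Countable (Chamber n) :=
  Function.Injective.countable (f := Chamber.pos) fun _ _ h => Chamber.ext h

instance (N : ℕ) : Countable (GT N) :=
  Function.Injective.countable (f := GT.level) fun _ _ h => GT.ext h

instance (n : ℕ) : MeasurableSingletonClass (Chamber n) := ⟨fun _ => trivial⟩

instance (N : ℕ) : MeasurableSingletonClass (GT N) := ⟨fun _ => trivial⟩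

theorem isMarkovProcess_level_last {rate : ℕ → ℝ} {M : ℝ} (hrate : UB rate)
    (hpos : ∀ a, 0 < rate a) (hM : ∀ a, |rate a| ≤ M) {Ω : Type*} [MeasurableSpace Ω]
    {μ : Measure Ω} [IsFiniteMeasure μ] {N : ℕ} {X : ℝ≥0 → Ω → GT (N + 1)}
    (hX : IsMarkovProcess μ X (expKernel (pushBlockGenerator rate)))
    {m : L1 (Chamber (N + 1))} (hm : ∀ x, μ.real {ω | X 0 ω = x} = gibbsOp hpos N m x) :
    IsMarkovProcess μ (fun t ω => (X t ω).level (Fin.last N))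
      fun t x y => levelSemigroup rate t x y := by
  refine hX.comp_of_intertwining (φ := fun x : GT (N + 1) => x.level (Fin.last N))
    measurable_from_top (expKernel_pushBlockGenerator hM) (levelSemigroup_eq_exp hrate hpos hM)
    (fun t => L1.exp_intertwine (gibbsOp_comp_levelDual hpos hM N) t) (fun z x hx => ?_)
    (fun z => by rw [mass_gibbsOp, L1.mass_dirac]) hm
  classical
  rw [gibbsOp_dirac_apply, if_neg hx]

/-- The top level is covered by the intertwining. A lower level is a level of the pattern without
its top, which is again push-block with a Gibbs initial law. -/
theorem isMarkovProcess_level {rate : ℕ → ℝ} {M : ℝ} (hrate : UB rate) (hpos : ∀ a, 0 < rate a)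
    (hM : ∀ a, |rate a| ≤ M) {Ω : Type*} [MeasurableSpace Ω] {μ : Measure Ω} [IsFiniteMeasure μ]
    {N : ℕ} {X : ℝ≥0 → Ω → GT (N + 1)}
    (hX : IsMarkovProcess μ X (expKernel (pushBlockGenerator rate)))
    {m : L1 (Chamber (N + 1))} (hm : ∀ x, μ.real {ω | X 0 ω = x} = gibbsOp hpos N m x)
    (k : Fin (N + 1)) :
    IsMarkovProcess μ (fun t ω => (X t ω).level k) fun t x y => levelSemigroup rate t x y := by
  induction N with
  | zero =>
    obtain rfl : k = Fin.last 0 := Fin.ext (by have := k.2; rw [Fin.val_last]; omega)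
    exact isMarkovProcess_level_last hrate hpos hM hX hm
  | succ N ih =>
    induction k using Fin.lastCases with
    | last => exact isMarkovProcess_level_last hrate hpos hM hX hm
    | cast k =>
      have hX' : IsMarkovProcess μ (fun t ω => (X t ω).dropTop)
          (expKernel (pushBlockGenerator rate)) :=
        hX.comp_of_lumping measurable_from_top (expKernel_pushBlockGenerator hM)
          (expKernel_pushBlockGenerator hM)
          fun t => L1.exp_intertwine (map_dropTop_comp_pushBlockDual hM) t
      refine ih hX' (m := levelOp hpos N m) (fun x => ?_) k
      rw [← map_dropTop_gibbsOp]
      have h := measureReal_comp_eq_map_restrictedLaw (μ := μ) hX.measurable GT.dropTop (fun _ => x)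
        (fun _ => 0) 0
      have h0 : restrictedLaw μ hX.measurable (fun _ => GT.dropTop ⁻¹' {x}) (fun _ => 0) 0 =
          gibbsOp hpos (N + 1) m := by
        ext y
        rw [restrictedLaw_apply, ← hm]
        simp
      rw [h0] at h
      simpa using h

theorem pushBlock_levels {rate : ℕ → ℝ} (hrate : UB rate) {N : ℕ}
    {Ω : Type*} [MeasurableSpace Ω] {μ : Measure Ω} [IsFiniteMeasure μ]
    {X : ℝ≥0 → Ω → GT (N + 1)} {m : L1 (Chamber (N + 1))}
    (hX : IsPushBlockProcess μ rate (gibbs rate m) X) :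
    (∀ k : Fin (N + 1),
      IsMarkovProcess μ (fun t ω => (X t ω).level k) fun t x y => levelSemigroup rate t x y) ∧
    ∀ (T : ℝ≥0) (x : GT (N + 1)), μ.real {ω | X T ω = x} =
      gibbs rate (fun z => ∑' w, m w * levelSemigroup rate (T : ℝ) w z) x := by
  obtain ⟨s, C, hs, hC⟩ := id hrate
  have hpos (a : ℕ) : 0 < rate a := hs.trans_le (hC a).1
  have hM (a : ℕ) : |rate a| ≤ C := by
    rw [abs_of_pos (hpos a)]
    exact (hC a).2
  have hm (x : GT (N + 1)) : μ.real {ω | X 0 ω = x} = gibbsOp hpos N m x := by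
    rw [hX.initial, gibbsOp_apply]
  refine ⟨isMarkovProcess_level hrate hpos hM hX.markov hm, fun T x => ?_⟩
  -- The law at time `T` is the evolved Gibbs law, which by the intertwining is the Gibbs law of the
  -- evolved top density.
  have h1 := congrArg (fun A => A m)
    (L1.exp_intertwine (gibbsOp_comp_levelDual hpos hM N) (T : ℝ))
  simp only [ContinuousLinearMap.comp_apply] at h1
  rw [hX.markov.measureReal_eq (expKernel_pushBlockGenerator hM) hm, ← h1, gibbsOp_apply]
  congr 1
  funext z
  rw [← (L1.hasSum_apply_apply _ m z).tsum_eq]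
  simp only [levelSemigroup_eq_exp hrate hpos hM]

theorem summable_measureReal_singleton {S : Type*} [Countable S] [MeasurableSpace S]
    [MeasurableSingletonClass S] (M : Measure S) [IsFiniteMeasure M] :
    Summable fun z => M.real {z} := by
  have h := (hasSum_measureReal_fiber (μ := M) measurable_id MeasurableSet.univ).summable
  simpa using h

end PushBlock

theorem mainTheorem3 (rate : ℕ → ℝ) (hrate : PushBlock.UB rate) (N : ℕ)
    (M : Measure (PushBlock.Chamber (N + 1))) [IsProbabilityMeasure M]
    {Ω : Type*} [MeasurableSpace Ω] (μ : Measure Ω) [IsProbabilityMeasure μ]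
    (X : ℝ≥0 → Ω → PushBlock.GT (N + 1))
    (hX : PushBlock.IsPushBlockProcess μ rate
      (PushBlock.gibbs rate fun z => M.real {z}) X) :
    (∀ k : Fin (N + 1),
      PushBlock.IsMarkovSemigroup
        (fun t (x y : PushBlock.Chamber ((k : ℕ) + 1)) => PushBlock.levelSemigroup rate t x y) ∧
      PushBlock.IsMarkovProcess μ (fun t ω => (X t ω).level k)
        (fun t x y => PushBlock.levelSemigroup rate t x y)) ∧
    ∀ (T : ℝ≥0) (x : PushBlock.GT (N + 1)),
      (μ.map (X T)).real {x} =
        PushBlock.gibbs rate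
          (fun z => ∑' w, M.real {w} * PushBlock.levelSemigroup rate (T : ℝ) w z) x := by
  have h := PushBlock.pushBlock_levels hrate
    (m := PushBlock.L1.ofSummable _ (PushBlock.summable_measureReal_singleton M)) hX
  refine ⟨fun k => ⟨PushBlock.isMarkovSemigroup_levelSemigroup hrate k, h.1 k⟩, fun T x => ?_⟩
  rw [map_measureReal_apply (hX.markov.measurable T) (MeasurableSet.singleton x)]
  exact h.2 T x

end
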